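/- Let $(W,S)$ be a Coxeter system with $W$ finite and length function $\ell$, let $\Gamma$ be a totally ordered abelian group (with order compatible with addition), and let $L\colon W\to\Gamma$ be a weight function, i.e. $L(ww')=L(w)+L(w')$ whenever $\ell(ww')=\ell(w)+\ell(w')$, such that $L(s)>0$ for all $s\in S$. Let $R\subseteq\mathbb{C}$ be a subring containing $2\cos(2\pi/m_{st})$ for all $s,t\in S$, where $m_{st}$ is the order of $st$. Let $F$ be the field of fractions of $R$, let $A=R[\Gamma]$ be the group ring with basis $\{\varepsilon^g\mid g\in\Gamma\}$, and let $K$ be the field of fractions of $A$. Let $\mathbf{H}$ be the generic Iwahori--Hecke algebra over $A$: the associative algebra, free over $A$ with basis $\{T_w\mid w\in W\}$, with identity $T_1$ and $$T_sT_w=\begin{cases}T_{sw}&\text{if }\ell(sw)>\ell(w),\\ T_{sw}+(\varepsilon^{L(s)}-\varepsilon^{-L(s)})T_w&\text{if }\ell(sw)<\ell(w)\end{cases}\qquad(s\in S,\ w\in W),$$ and let $\mathbf{H}_K=K\otimes_A\mathbf{H}$. Every non-zero $x\in K$ can be written as $x=r_x\varepsilon^{g_x}(1+p)/(1+q)$ with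 unique $0\ne r_x\in F$ and $g_x\in\Gamma$, where $p,q$ are $F$-linear combinations of terms $\varepsilon^g$ with $g>0$. Let $\mathcal{O}=\{0\}\cup\{x\mid g_x\ge 0\}$ and $\mathfrak{p}=\{0\}\cup\{x\mid g_x>0\}$; the constant term of $x\in\mathcal{O}$ is the unique $r\in F$ with $x-r\in\mathfrak{p}$. Let $\{E^\lambda\mid\lambda\in\Lambda\}$ be a complete set of representatives of the irreducible complex representations of $W$, and $d_\lambda=\dim E^\lambda$. For each $\lambda\in\Lambda$ let $\rho^\lambda\colon\mathbf{H}_K\to M_{d_\lambda}(K)$ be an irreducible matrix representation that corresponds to $E^\lambda$, i.e. for all $w\in W$ we have $\operatorname{trace}\rho^\lambda(T_w)\in A$ and $\theta_1(\operatorname{trace}\rho^\lambda(T_w))=\operatorname{trace}(w,E^\lambda)$, where $\theta_1\colon A\to R$ is the $R$-linear ring homomorphism with $\theta_1(\varepsilon^g)=1$ for all $g$. Let $\boldsymbol{c}_\lambda\in K$ be defined by $\sum_{w\in W}\operatorname{trace}\rho^\lambda(T_w)\operatorname{trace}\rho^\lambda(T_{w^{-1}})=d_\lambda\boldsymbol{c}_\lambda$,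 and let $\boldsymbol{a}_\lambda\in\Gamma$, $0\ne f_\lambda\in F$ be determined by $$\boldsymbol{c}_\lambda=f_\lambda\varepsilon^{-2\boldsymbol{a}_\lambda}+\text{an $F$-linear combination of terms }\varepsilon^g\text{ with }g>-2\boldsymbol{a}_\lambda .$$ Assume that every $\rho^\lambda$ is balanced, i.e. $\varepsilon^{\boldsymbol{a}_\lambda}\rho^\lambda_{ij}(T_w)\in\mathcal{O}$ for all $w\in W$ and all $i,j$, and let $c_{w,\lambda}^{ij}\in F$ be the constant term of $(-1)^{\ell(w)}\varepsilon^{\boldsymbol{a}_\lambda}\rho^\lambda_{ij}(T_w)$. For $w,x,y,z\in W$ set $$\tilde\gamma_{x,y,z}=\sum_{\lambda\in\Lambda}\sum_{1\le i,j,k\le d_\lambda}f_\lambda^{-1}c_{x,\lambda}^{ij}c_{y,\lambda}^{jk}c_{z,\lambda}^{ki},\qquad \tilde n_w=\sum_{\lambda\in\Lambda}\sum_{1\le i\le d_\lambda}f_\lambda^{-1}c_{w^{-1},\lambda}^{ii},$$ and $\tilde{\mathcal{D}}=\{w\in W\mid\tilde n_w\ne 0\}$. Let $\tilde{\mathbf{J}}$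 be the $F$-vector space with basis $\{t_w\mid w\in W\}$ and the bilinear product given by $t_xt_y=\sum_{z\in W}\tilde\gamma_{x,y,z^{-1}}\,t_z$. Then $\tilde{\mathbf{J}}$ is an associative algebra with identity element $\sum_{w\in\tilde{\mathcal{D}}}\tilde n_w t_w$. -/

import Mathlib

namespace IwahoriHecke

section Exchange

variable {B W : Type*} [Group W] {M : CoxeterMatrix B} (cs : CoxeterSystem M W)

theorem end_mul_apply {α : Type*} (f g : Function.End α) (p : α) : (f * g) p = f (g p) := rfl

open Classical in
/-- The involution `(t, e) ↦ (s t s, e + [t = s])` of `W × ℤ/2` attached to a simple reflection. -/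
noncomputable def parityOp (i : B) : Function.End (W × ZMod 2) :=
  fun p => (cs.simple i * p.1 * cs.simple i, p.2 + if p.1 = cs.simple i then 1 else 0)

open Classical in
theorem parityOp_mul_pow (i j : B) (n : ℕ) (p : W × ZMod 2) :
    ((parityOp cs i * parityOp cs j) ^ n) p =
      ((cs.simple i * cs.simple j) ^ n * p.1 * ((cs.simple i * cs.simple j) ^ n)⁻¹,
        p.2 + ∑ k ∈ Finset.range (2 * n),
          if p.1 = cs.simple j * (cs.simple i * cs.simple j) ^ k then 1 else 0) := by
  set c := cs.simple i * cs.simple j with hc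
  have hci : c⁻¹ = cs.simple j * cs.simple i := by simp [hc]
  have hconj : ∀ k : ℕ, (c ^ k)⁻¹ * cs.simple j = cs.simple j * c ^ k := by
    intro k
    induction k with
    | zero => simp
    | succ k ih =>
      nth_rw 1 [pow_succ]
      rw [mul_inv_rev, mul_assoc, ih, ← mul_assoc, hci, pow_succ']
      simp [hc, mul_assoc]
  induction n with
  | zero => simp; rfl
  | succ n ih =>
    rw [pow_succ', end_mul_apply, ih, end_mul_apply]
    refine Prod.ext ?_ ?_
    · simp only [parityOp, pow_succ' c n, mul_inv_rev, hci]
      simp only [hc, mul_assoc]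
    · have e1 : (c ^ n * p.1 * (c ^ n)⁻¹ = cs.simple j) ↔ p.1 = cs.simple j * c ^ (2 * n) := by
        rw [mul_inv_eq_iff_eq_mul, ← eq_inv_mul_iff_mul_eq, ← mul_assoc, hconj, mul_assoc,
          ← pow_add, two_mul]
      have e2 : (cs.simple j * (c ^ n * p.1 * (c ^ n)⁻¹) * cs.simple j = cs.simple i) ↔
          p.1 = cs.simple j * c ^ (2 * n + 1) := by
        have h1 : c ^ (2 * n + 1) = c ^ n * c * c ^ n := by
          rw [← pow_succ, ← pow_add]; congr 1; ring
        have h2 : cs.simple j * (c ^ n * c * c ^ n) =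
            (c ^ n)⁻¹ * (cs.simple j * cs.simple i * cs.simple j) * c ^ n := by
          rw [← mul_assoc, ← mul_assoc, ← hconj]
          simp only [hc, mul_assoc]
        rw [h1, h2]
        constructor
        · intro h
          rw [← h]
          simp [mul_assoc]
        · intro h
          rw [h]
          simp [mul_assoc]
      simp only [parityOp]
      rw [show 2 * (n + 1) = 2 * n + 1 + 1 by ring, Finset.sum_range_succ, Finset.sum_range_succ]
      simp only [e1, e2]
      ring

theorem parityOp_isLiftable : M.IsLiftable (parityOp cs) := by
  classical
  intro i j
  funext p
  rw [parityOp_mul_pow, cs.simple_mul_simple_pow, two_mul, Finset.sum_range_add]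
  simp only [pow_add, cs.simple_mul_simple_pow, one_mul]
  refine Prod.ext (by simp; rfl) ?_
  have : ∀ x : ZMod 2, x + x = 0 := by decide
  rw [this, add_zero]
  rfl

/-- The action of `W` on `W × ℤ/2` that counts inversions modulo two. -/
noncomputable def parityHom : W →* Function.End (W × ZMod 2) :=
  cs.lift ⟨parityOp cs, parityOp_isLiftable cs⟩

open Classical in
theorem parityHom_wordProd (ω : List B) (p : W × ZMod 2) :
    parityHom cs (cs.wordProd ω) p =
      (cs.wordProd ω * p.1 * (cs.wordProd ω)⁻¹, p.2 + ((cs.rightInvSeq ω).count p.1 : ZMod 2)) := by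
  induction ω with
  | nil => simp; rfl
  | cons i ω ih =>
    rw [cs.wordProd_cons, map_mul, end_mul_apply, ih, parityHom,
      cs.lift_apply_simple]
    refine Prod.ext (by simp [parityOp, mul_assoc]) ?_
    have e : (cs.wordProd ω * p.1 * (cs.wordProd ω)⁻¹ = cs.simple i) ↔
        (cs.wordProd ω)⁻¹ * cs.simple i * cs.wordProd ω = p.1 := by
      rw [mul_inv_eq_iff_eq_mul, ← eq_inv_mul_iff_mul_eq, eq_comm, mul_assoc]
    simp only [parityOp, CoxeterSystem.rightInvSeq, List.count_cons, e, beq_iff_eq]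
    push_cast
    ring

theorem mem_rightInvSeq_of_isRightDescent {ω : List B} {j : B}
    (h : cs.IsRightDescent (cs.wordProd ω) j) : cs.simple j ∈ cs.rightInvSeq ω := by
  classical
  by_contra hmem
  obtain ⟨ω', hω', hw⟩ := cs.exists_isReduced (cs.wordProd ω * cs.simple j)
  have h1 := parityHom_wordProd cs ω' (cs.simple j, 0)
  have h2 := parityHom_wordProd cs ω (cs.simple j, 1)
  rw [List.count_eq_zero_of_not_mem hmem] at h2
  rw [← hw, map_mul, end_mul_apply] at h1
  have h3 : parityHom cs (cs.simple j) (cs.simple j, 0) = (cs.simple j, 1) := by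
    rw [parityHom, cs.lift_apply_simple]
    simp [parityOp]
  rw [h3, h2] at h1
  have h4 := congrArg Prod.snd h1
  have h5 : cs.simple j ∈ cs.rightInvSeq ω' := by
    by_contra hn
    rw [List.count_eq_zero_of_not_mem hn] at h4
    simp at h4
  have h6 := (cs.isRightInversion_of_mem_rightInvSeq hω' h5).2
  rw [← hw, cs.simple_mul_simple_cancel_right] at h6
  exact absurd h (not_lt.mpr h6.le)

/-- If `sw > w`, `wt > w` and `swt < sw` for simple reflections `s, t`, then `sw = wt`. -/
theorem simple_mul_eq_mul_simple {w : W} {i j : B} (hi : cs.length w < cs.length (cs.simple i * w))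
    (hj : cs.length w < cs.length (w * cs.simple j))
    (hij : cs.length (cs.simple i * w * cs.simple j) < cs.length (cs.simple i * w)) :
    cs.simple i * w = w * cs.simple j := by
  obtain ⟨ω, hω, rfl⟩ := cs.exists_isReduced w
  have h : cs.simple j ∈ cs.rightInvSeq (i :: ω) := by
    apply mem_rightInvSeq_of_isRightDescent
    rw [cs.wordProd_cons]
    exact hij
  rw [CoxeterSystem.rightInvSeq, List.mem_cons] at h
  rcases h with h | h
  · rw [h]; simp [mul_assoc]
  · exact absurd (cs.isRightInversion_of_mem_rightInvSeq hω h).2 (not_lt.mpr hj.le)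

end Exchange

section Hecke

variable {B W : Type*} [Group W] {M : CoxeterMatrix B} {cs : CoxeterSystem M W}
  {Γ : Type*} [AddCommGroup Γ]

variable (cs Γ) in
/-- Weight functions: `L (w * w') = L w + L w'` whenever `ℓ (w * w') = ℓ w + ℓ w'`. -/
structure WeightFunction where
  /-- The underlying function. -/
  toFun : W → Γ
  map_mul : ∀ w w' : W, cs.length (w * w') = cs.length w + cs.length w' →
    toFun (w * w') = toFun w + toFun w'

variable (L : WeightFunction cs Γ) (R : Type*) [CommRing R]

/-- The element `v_s - v_s⁻¹` of `A = R[Γ]`, where `v_s = ε^{L(s)}`. -/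
noncomputable def heckeParam (i : B) : AddMonoidAlgebra R Γ :=
  .single (L.toFun (cs.simple i)) 1 - .single (-L.toFun (cs.simple i)) 1

variable {L} in
theorem weight_simple_eq {w : W} {i j : B} (hi : cs.length w < cs.length (cs.simple i * w))
    (h : cs.simple i * w = w * cs.simple j) :
    L.toFun (cs.simple i) = L.toFun (cs.simple j) := by
  have hl : cs.length (cs.simple i * w) = cs.length w + 1 := by
    rcases cs.length_simple_mul w i with h | h <;> omega
  have h1 := L.map_mul (cs.simple i) w (by rw [hl, cs.length_simple, add_comm])
  have h2 := L.map_mul w (cs.simple j) (by rw [← h, hl, cs.length_simple])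
  rw [h, h2, add_comm] at h1
  exact (add_right_cancel h1).symm

/-- The underlying free module, with basis indexed by `W`, of the generic Iwahori--Hecke algebra
`H = H_A(W, S, L)` over `A = R[Γ]`. -/
@[nolint unusedArguments]
def HeckeAlgebra (_L : WeightFunction cs Γ) (R : Type*) [CommRing R] : Type _ :=
  W →₀ AddMonoidAlgebra R Γ

namespace HeckeAlgebra

noncomputable instance : AddCommGroup (HeckeAlgebra L R) :=
  inferInstanceAs (AddCommGroup (W →₀ AddMonoidAlgebra R Γ))

noncomputable instance : Module (AddMonoidAlgebra R Γ) (HeckeAlgebra L R) :=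
  inferInstanceAs (Module (AddMonoidAlgebra R Γ) (W →₀ AddMonoidAlgebra R Γ))

/-- The standard basis `T_w`, `w ∈ W`. -/
noncomputable def basis : Module.Basis W (AddMonoidAlgebra R Γ) (HeckeAlgebra L R) :=
  ⟨LinearEquiv.refl _ _⟩

/-- The element `T_w`. -/
noncomputable def T (w : W) : HeckeAlgebra L R := basis L R w

open Classical in
/-- Left multiplication by `T_s`. -/
noncomputable def leftOp (i : B) : Module.End (AddMonoidAlgebra R Γ) (HeckeAlgebra L R) :=
  (basis L R).constr (AddMonoidAlgebra R Γ) fun w =>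
    if cs.length w < cs.length (cs.simple i * w) then T L R (cs.simple i * w)
    else T L R (cs.simple i * w) + heckeParam L R i • T L R w

open Classical in
/-- Right multiplication by `T_s`. -/
noncomputable def rightOp (i : B) : Module.End (AddMonoidAlgebra R Γ) (HeckeAlgebra L R) :=
  (basis L R).constr (AddMonoidAlgebra R Γ) fun w =>
    if cs.length w < cs.length (w * cs.simple i) then T L R (w * cs.simple i)
    else T L R (w * cs.simple i) + heckeParam L R i • T L R w

open Classical in
theorem leftOp_T (i : B) (w : W) : leftOp L R i (T L R w) =
    if cs.length w < cs.length (cs.simple i * w) then T L R (cs.simple i * w)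
    else T L R (cs.simple i * w) + heckeParam L R i • T L R w := by
  rw [leftOp, T, Module.Basis.constr_basis]
  rfl

open Classical in
theorem rightOp_T (i : B) (w : W) : rightOp L R i (T L R w) =
    if cs.length w < cs.length (w * cs.simple i) then T L R (w * cs.simple i)
    else T L R (w * cs.simple i) + heckeParam L R i • T L R w := by
  rw [rightOp, T, Module.Basis.constr_basis]
  rfl

theorem commute_leftOp_rightOp (i j : B) : Commute (leftOp L R i) (rightOp L R j) := by
  refine (basis L R).ext fun w => ?_
  change leftOp L R i (rightOp L R j (T L R w)) = rightOp L R j (leftOp L R i (T L R w))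
  have hA := cs.length_simple_mul w i
  have hB := cs.length_mul_simple w j
  have hC := cs.length_simple_mul (w * cs.simple j) i
  have hD := cs.length_mul_simple (cs.simple i * w) j
  rw [mul_assoc] at hD
  have hpar : cs.simple i * w = w * cs.simple j → heckeParam L R i = heckeParam L R j := by
    intro h
    unfold heckeParam
    have : L.toFun (cs.simple i) = L.toFun (cs.simple j) := by
      by_cases hlt : cs.length w < cs.length (cs.simple i * w)
      · exact weight_simple_eq hlt h
      · refine weight_simple_eq (w := cs.simple i * w) ?_ ?_
        · rw [cs.simple_mul_simple_cancel_left]; omega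
        · rw [h, cs.simple_mul_simple_cancel_right, ← h, cs.simple_mul_simple_cancel_left]
    rw [this]
  by_cases h1 : cs.length w < cs.length (cs.simple i * w) <;>
  by_cases h2 : cs.length w < cs.length (w * cs.simple j)
  · by_cases h3 : cs.length (w * cs.simple j) < cs.length (cs.simple i * (w * cs.simple j))
    · have h4 : cs.length (cs.simple i * w) < cs.length (cs.simple i * (w * cs.simple j)) := by
        omega
      simp [leftOp_T, rightOp_T, h1, h2, h3, h4, mul_assoc]
    · have h4 : ¬ cs.length (cs.simple i * w) < cs.length (cs.simple i * (w * cs.simple j)) := by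
        omega
      have h5 := simple_mul_eq_mul_simple cs h1 h2 (by rw [mul_assoc]; omega)
      simp [leftOp_T, rightOp_T, h1, h2, h3, h4, mul_assoc, hpar h5]
      rw [h5]
  · have h3 : cs.length (w * cs.simple j) < cs.length (cs.simple i * (w * cs.simple j)) := by
      omega
    have h4 : ¬ cs.length (cs.simple i * w) < cs.length (cs.simple i * (w * cs.simple j)) := by
      omega
    simp [leftOp_T, rightOp_T, h1, h2, h3, h4, mul_assoc]
  · have h3 : ¬ cs.length (w * cs.simple j) < cs.length (cs.simple i * (w * cs.simple j)) := by
      omega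
    have h4 : cs.length (cs.simple i * w) < cs.length (cs.simple i * (w * cs.simple j)) := by
      omega
    simp [leftOp_T, rightOp_T, h1, h2, h3, h4, mul_assoc]
  · by_cases h3 : cs.length (w * cs.simple j) < cs.length (cs.simple i * (w * cs.simple j))
    · have h4 : cs.length (cs.simple i * w) < cs.length (cs.simple i * (w * cs.simple j)) := by
        omega
      have h5 := simple_mul_eq_mul_simple cs (w := cs.simple i * w) (i := i) (j := j)
        (by rw [cs.simple_mul_simple_cancel_left]; omega) (by rw [mul_assoc]; exact h4)
        (by rw [cs.simple_mul_simple_cancel_left]; omega)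
      have h6 : cs.simple i * w = w * cs.simple j := by
        rw [cs.simple_mul_simple_cancel_left] at h5
        conv_rhs => rw [h5, cs.simple_mul_simple_cancel_right]
      have h7 := hpar h6
      simp [leftOp_T, rightOp_T, h1, h2, h3, h4, mul_assoc, h7]
      rw [h6]
    · have h4 : ¬ cs.length (cs.simple i * w) < cs.length (cs.simple i * (w * cs.simple j)) := by
        omega
      simp [leftOp_T, rightOp_T, h1, h2, h3, h4, mul_assoc]
      simp only [smul_smul, mul_comm]
      abel

theorem rightOp_prod_T_one {ω : List B} (hω : cs.IsReduced ω) :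
    ((ω.reverse.map (rightOp L R)).prod) (T L R 1) = T L R (cs.wordProd ω) := by
  induction ω using List.reverseRecOn with
  | nil => simp
  | append_singleton ω j ih =>
    have h1 : cs.IsReduced ω := by simpa using hω.take ω.length
    have h2 : cs.length (cs.wordProd ω) < cs.length (cs.wordProd ω * cs.simple j) := by
      have := hω.eq
      rw [cs.wordProd_append, cs.wordProd_singleton, List.length_append] at this
      rw [this, h1.eq]; simp
    rw [List.reverse_append, List.map_append, List.prod_append, Module.End.mul_apply, ih h1]
    simp [rightOp_T, h2, cs.wordProd_append]

theorem leftOp_prod_T_one {ω : List B} (hω : cs.IsReduced ω) :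
    ((ω.map (leftOp L R)).prod) (T L R 1) = T L R (cs.wordProd ω) := by
  induction ω with
  | nil => simp
  | cons i ω ih =>
    have h1 : cs.IsReduced ω := by simpa using hω.drop 1
    have h2 : cs.length (cs.wordProd ω) < cs.length (cs.simple i * cs.wordProd ω) := by
      have := hω.eq
      rw [cs.wordProd_cons, List.length_cons] at this
      rw [this, h1.eq]; simp
    rw [List.map_cons, List.prod_cons, Module.End.mul_apply, ih h1]
    simp [leftOp_T, h2, cs.wordProd_cons]

/-- An endomorphism commuting with all right multiplications is determined by its value at
`T_1`. -/
theorem end_eq_of_apply_one {f g : Module.End (AddMonoidAlgebra R Γ) (HeckeAlgebra L R)}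
    (hf : ∀ j, Commute f (rightOp L R j)) (hg : ∀ j, Commute g (rightOp L R j))
    (h : f (T L R 1) = g (T L R 1)) : f = g := by
  refine (basis L R).ext fun w => ?_
  change f (T L R w) = g (T L R w)
  obtain ⟨ω, hω, rfl⟩ := cs.exists_isReduced w
  rw [← rightOp_prod_T_one L R hω]
  have key : ∀ f : Module.End (AddMonoidAlgebra R Γ) (HeckeAlgebra L R),
      (∀ j, Commute f (rightOp L R j)) → Commute f ((ω.reverse.map (rightOp L R)).prod) := by
    intro f hf
    refine Commute.list_prod_right _ _ fun y hy => ?_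
    obtain ⟨j, -, rfl⟩ := List.mem_map.mp hy
    exact hf j
  rw [← Module.End.mul_apply, ← Module.End.mul_apply, (key f hf).eq, (key g hg).eq,
    Module.End.mul_apply, Module.End.mul_apply, h]

/-- Left multiplication by an element, as the `A`-linear map sending `T_w` to the product of the
left multiplications by `T_s` along a reduced word of `w`. -/
noncomputable def lmul :
    HeckeAlgebra L R →ₗ[AddMonoidAlgebra R Γ]
      Module.End (AddMonoidAlgebra R Γ) (HeckeAlgebra L R) :=
  (basis L R).constr (AddMonoidAlgebra R Γ) fun w =>
    ((cs.exists_isReduced w).choose.map (leftOp L R)).prod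

theorem lmul_T (w : W) : lmul L R (T L R w) =
    ((cs.exists_isReduced w).choose.map (leftOp L R)).prod := by
  rw [lmul, T, Module.Basis.constr_basis]

theorem lmul_apply_one (x : HeckeAlgebra L R) : lmul L R x (T L R 1) = x := by
  have : (LinearMap.applyₗ (T L R 1)).comp (lmul L R) = LinearMap.id := by
    refine (basis L R).ext fun w => ?_
    change lmul L R (T L R w) (T L R 1) = T L R w
    rw [lmul_T]
    have h := (cs.exists_isReduced w).choose_spec
    rw [leftOp_prod_T_one L R h.1, ← h.2]
  exact LinearMap.congr_fun this x

theorem commute_lmul_rightOp (x : HeckeAlgebra L R) (j : B) :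
    Commute (lmul L R x) (rightOp L R j) := by
  have hx : x ∈ Submodule.span (AddMonoidAlgebra R Γ) (Set.range (basis L R)) :=
    (basis L R).mem_span x
  induction hx using Submodule.span_induction with
  | zero => rw [map_zero]; exact Commute.zero_left _
  | add x y _ _ hx hy => rw [map_add]; exact hx.add_left hy
  | smul a x _ hx => rw [map_smul]; exact hx.smul_left a
  | mem x hx =>
    obtain ⟨w, rfl⟩ := hx
    change Commute (lmul L R (T L R w)) _
    rw [lmul_T]
    refine Commute.list_prod_left _ _ fun y hy => ?_
    obtain ⟨i, -, rfl⟩ := List.mem_map.mp hy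
    exact commute_leftOp_rightOp L R i j

noncomputable instance : Mul (HeckeAlgebra L R) := ⟨fun x y => lmul L R x y⟩

noncomputable instance : One (HeckeAlgebra L R) := ⟨T L R 1⟩

theorem mul_eq_lmul (x y : HeckeAlgebra L R) : x * y = lmul L R x y := rfl

theorem one_eq_T : (1 : HeckeAlgebra L R) = T L R 1 := rfl

theorem lmul_mul (x y : HeckeAlgebra L R) : lmul L R (x * y) = lmul L R x * lmul L R y := by
  refine end_eq_of_apply_one L R (commute_lmul_rightOp L R _)
    (fun j => (commute_lmul_rightOp L R x j).mul_left (commute_lmul_rightOp L R y j)) ?_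
  rw [lmul_apply_one, Module.End.mul_apply, lmul_apply_one, mul_eq_lmul]

theorem lmul_one : lmul L R 1 = 1 := by
  refine end_eq_of_apply_one L R (commute_lmul_rightOp L R _)
    (fun j => Commute.one_left _) ?_
  rw [lmul_apply_one, Module.End.one_apply, one_eq_T]

noncomputable instance : Ring (HeckeAlgebra L R) :=
  { (inferInstance : AddCommGroup (HeckeAlgebra L R)),
    (inferInstance : Mul (HeckeAlgebra L R)),
    (inferInstance : One (HeckeAlgebra L R)) with
    left_distrib := fun x y z => map_add (lmul L R x) y z
    right_distrib := fun x y z => by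
      rw [mul_eq_lmul, map_add, LinearMap.add_apply]; rfl
    zero_mul := fun x => by rw [mul_eq_lmul, map_zero, LinearMap.zero_apply]
    mul_zero := fun x => map_zero (lmul L R x)
    mul_assoc := fun x y z => by
      rw [mul_eq_lmul, lmul_mul, Module.End.mul_apply]; rfl
    one_mul := fun x => by rw [mul_eq_lmul, lmul_one, Module.End.one_apply]
    mul_one := fun x => lmul_apply_one L R x }

noncomputable instance : Algebra (AddMonoidAlgebra R Γ) (HeckeAlgebra L R) :=
  Algebra.ofModule
    (fun a x y => by rw [mul_eq_lmul, map_smul, LinearMap.smul_apply]; rfl)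
    (fun a x y => map_smul (lmul L R x) a y)

open Classical in
/-- The defining multiplication rule of the Iwahori--Hecke algebra. -/
theorem T_simple_mul_T (i : B) (w : W) : T L R (cs.simple i) * T L R w =
    if cs.length w < cs.length (cs.simple i * w) then T L R (cs.simple i * w)
    else T L R (cs.simple i * w) + heckeParam L R i • T L R w := by
  have h : lmul L R (T L R (cs.simple i)) = leftOp L R i := by
    refine end_eq_of_apply_one L R (commute_lmul_rightOp L R _)
      (commute_leftOp_rightOp L R i) ?_
    rw [lmul_apply_one, leftOp_T]
    simp
  rw [mul_eq_lmul, h, leftOp_T]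

end HeckeAlgebra

end Hecke

section Valuation

variable {Γ : Type*} [AddCommGroup Γ] [LinearOrder Γ] [IsOrderedAddMonoid Γ]
  (R : Type*) [CommRing R] [IsDomain R]
  (F : Type*) [Field F] [Algebra R F] [IsFractionRing R F]
  {K : Type*} [Field K] [Algebra (AddMonoidAlgebra R Γ) K]
  [IsFractionRing (AddMonoidAlgebra R Γ) K]

/-- The homomorphism `g ↦ ε^g` from `Γ` to the multiplicative monoid of `K = Frac R[Γ]`. -/
noncomputable def epsHom (K : Type*) [Field K] [Algebra (AddMonoidAlgebra R Γ) K] :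
    Multiplicative Γ →* K :=
  ((algebraMap (AddMonoidAlgebra R Γ) K : AddMonoidAlgebra R Γ →* K)).comp
    (AddMonoidAlgebra.of R Γ)

/-- The element `ε^g` of `K = Frac R[Γ]`. -/
noncomputable def eps (K : Type*) [Field K] [Algebra (AddMonoidAlgebra R Γ) K] (g : Γ) : K :=
  algebraMap (AddMonoidAlgebra R Γ) K (AddMonoidAlgebra.single g 1)

variable (Γ K) in
theorem injective_constants : Function.Injective
    ((algebraMap (AddMonoidAlgebra R Γ) K).comp
      (AddMonoidAlgebra.singleZeroRingHom (R := R) (M := Γ))) :=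
  (IsFractionRing.injective (AddMonoidAlgebra R Γ) K).comp
    AddMonoidAlgebra.single_right_injective

variable (Γ K) in
/-- The inclusion of `F = Frac R` in `K = Frac R[Γ]`. -/
noncomputable def scalarHom : F →+* K :=
  IsFractionRing.lift (injective_constants Γ R K)

variable (K) in
/-- The inclusion of `F[Γ]` in `K = Frac R[Γ]`. -/
noncomputable def laurentHom : AddMonoidAlgebra F Γ →+* K :=
  AddMonoidAlgebra.liftNCRingHom (scalarHom Γ R F K) (epsHom R K) fun _ _ => Commute.all _ _

variable {F} in
/-- `p ∈ F[Γ_{>0}]`. -/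
def PosSupport (p : AddMonoidAlgebra F Γ) : Prop := ∀ g ∈ p.coeff.support, 0 < g

/-- `x = r ε^g (1 + p) / (1 + q)` with `p, q ∈ F[Γ_{>0}]`. -/
def HasNormalForm (x : K) (r : F) (g : Γ) : Prop :=
  ∃ p q : AddMonoidAlgebra F Γ, PosSupport p ∧ PosSupport q ∧
    x = scalarHom Γ R F K r * eps R K g * (laurentHom R F K (1 + p) / laurentHom R F K (1 + q))

variable (Γ K) in
/-- The valuation ring `𝒪` (as a set). -/
def valRing : Set K := {x | x = 0 ∨ ∃ (r : F) (g : Γ), 0 ≤ g ∧ HasNormalForm R F x r g}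

variable (Γ K) in
/-- The maximal ideal `𝔭` of `𝒪` (as a set). -/
def valIdeal : Set K := {x | x = 0 ∨ ∃ (r : F) (g : Γ), 0 < g ∧ HasNormalForm R F x r g}

variable (Γ) in
/-- The constant term of `x ∈ 𝒪`: the unique `r ∈ F` with `x - r ∈ 𝔭`. -/
noncomputable def constTerm (x : K) : F :=
  Classical.epsilon fun r : F => x - scalarHom Γ R F K r ∈ valIdeal Γ R F K

/-- `c = r ε^g +` an `F`-linear combination of terms `ε^h` with `h > g`, where `r ≠ 0`. -/
def HasLowestTerm (c : K) (g : Γ) (r : F) : Prop :=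
  r ≠ 0 ∧ ∃ q : AddMonoidAlgebra F Γ, (∀ h ∈ q.coeff.support, g < h) ∧
    c = scalarHom Γ R F K r * eps R K g + laurentHom R F K q

end Valuation

section Representations

variable {B W : Type*} [Group W] [Fintype W] {M : CoxeterMatrix B} {cs : CoxeterSystem M W}
  {Γ : Type*} [AddCommGroup Γ] [LinearOrder Γ] [IsOrderedAddMonoid Γ]

/-- `{E^λ}` is a complete set of representatives of the isomorphism classes of irreducible
complex representations of the finite group `W`. -/
structure IsCompleteIrr {Λ : Type*} {d : Λ → ℕ}
    (E : ∀ l, Representation ℂ W (Fin (d l) → ℂ)) : Prop where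
  irreducible : ∀ l, (E l).IsIrreducible
  injective : ∀ l m, Nonempty ((E l).Equiv (E m)) → l = m
  surjective : ∀ (n : ℕ) (V : Representation ℂ W (Fin n → ℂ)), V.IsIrreducible →
    ∃ l, Nonempty (V.Equiv (E l))

/-- The specialisation `θ₁ : R[Γ] → R`, `ε^g ↦ 1`. -/
noncomputable def theta (R : Type*) [CommRing R] : AddMonoidAlgebra R Γ →ₐ[R] R :=
  AddMonoidAlgebra.lift R R Γ 1

open scoped TensorProduct

variable (L : WeightFunction cs Γ) (R : Type*) [CommRing R] [IsDomain R]
  (F : Type*) [Field F] [Algebra R F] [IsFractionRing R F]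
  (K : Type*) [Field K] [Algebra (AddMonoidAlgebra R Γ) K]
  [IsFractionRing (AddMonoidAlgebra R Γ) K]

/-- Matrix representations of degree `d` of `H_K = K ⊗_A H`. -/
abbrev MatrixRep (d : ℕ) : Type _ :=
  (K ⊗[AddMonoidAlgebra R Γ] HeckeAlgebra L R) →ₐ[K] Matrix (Fin d) (Fin d) K

variable {L R K} {d : ℕ} (ρ : MatrixRep L R K d)

/-- The matrix `ρ(T_w)`. -/
noncomputable def repT (w : W) : Matrix (Fin d) (Fin d) K := ρ (1 ⊗ₜ HeckeAlgebra.T L R w)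

/-- `ρ` is irreducible: `K^d` is non-zero and has no invariant subspaces but `0` and `K^d`. -/
def IsIrreducibleRep : Prop :=
  d ≠ 0 ∧ ∀ U : Submodule K (Fin d → K), (∀ h, ∀ v ∈ U, (ρ h).mulVec v ∈ U) → U = ⊥ ∨ U = ⊤

/-- `ρ` is an irreducible representation of `H_K` that corresponds to the irreducible
representation `E` of `W`: the traces of the `T_w` lie in `A = R[Γ]` and
`θ₁(trace ρ(T_w)) = trace(w, E)` for all `w ∈ W`. -/
def IsAffordedBy {R : Subring ℂ} {K : Type*} [Field K] [Algebra (AddMonoidAlgebra R Γ) K]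
    (ρ : MatrixRep L R K d) (E : Representation ℂ W (Fin d → ℂ)) : Prop :=
  IsIrreducibleRep ρ ∧
    ∀ w : W, ∃ a : AddMonoidAlgebra R Γ,
      algebraMap (AddMonoidAlgebra R Γ) K a = (repT ρ w).trace ∧
        ((theta R a : R) : ℂ) = E.character w

/-- The element `c_λ`, given by `∑_w trace ρ(T_w) trace ρ(T_{w⁻¹}) = d_λ c_λ`. -/
noncomputable def schurElement : K :=
  (d : K)⁻¹ * ∑ w : W, (repT ρ w).trace * (repT ρ w⁻¹).trace

/-- The invariant `a_λ`: the lowest term of `c_λ` is `f_λ ε^{-2 a_λ}`. -/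
noncomputable def aInv : Γ :=
  Classical.epsilon fun a : Γ => ∃ f : F, HasLowestTerm R F (schurElement ρ) (-(2 • a)) f

/-- The invariant `f_λ`: the lowest term of `c_λ` is `f_λ ε^{-2 a_λ}`. -/
noncomputable def fInv : F :=
  Classical.epsilon fun f : F => ∃ a : Γ, HasLowestTerm R F (schurElement ρ) (-(2 • a)) f

/-- `ρ` is balanced: `ε^{a_λ} ρ_{ij}(T_w) ∈ 𝒪` for all `w`, `i`, `j`. -/
def IsBalanced : Prop :=
  ∀ (w : W) (i j : Fin d), eps R K (aInv F ρ) * repT ρ w i j ∈ valRing Γ R F K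

/-- The leading matrix coefficient `c_{w,λ}^{ij}`: the constant term of
`(-1)^{ℓ(w)} ε^{a_λ} ρ_{ij}(T_w)`. -/
noncomputable def leadCoeff (w : W) (i j : Fin d) : F :=
  constTerm Γ R F ((-1) ^ cs.length w * eps R K (aInv F ρ) * repT ρ w i j)

end Representations

section JTilde

variable {B W : Type*} [Group W] [Fintype W] {M : CoxeterMatrix B} {cs : CoxeterSystem M W}
  {Γ : Type*} [AddCommGroup Γ] [LinearOrder Γ] [IsOrderedAddMonoid Γ]
  {L : WeightFunction cs Γ} {R : Type*} [CommRing R] [IsDomain R]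
  (F : Type*) [Field F] [Algebra R F] [IsFractionRing R F]
  {K : Type*} [Field K] [Algebra (AddMonoidAlgebra R Γ) K]
  [IsFractionRing (AddMonoidAlgebra R Γ) K]
  {Λ : Type*} [Fintype Λ] {d : Λ → ℕ} (ρ : ∀ l, MatrixRep L R K (d l))

/-- The constants `γ̃_{x,y,z}`. -/
noncomputable def gammaTilde (x y z : W) : F :=
  ∑ l : Λ, ∑ i, ∑ j, ∑ k, (fInv F (ρ l))⁻¹ *
    leadCoeff F (ρ l) x i j * leadCoeff F (ρ l) y j k * leadCoeff F (ρ l) z k i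

/-- The constants `ñ_w`. -/
noncomputable def nTilde (w : W) : F :=
  ∑ l : Λ, ∑ i, (fInv F (ρ l))⁻¹ * leadCoeff F (ρ l) w⁻¹ i i

/-- The bilinear product on the `F`-vector space `J̃ = W →₀ F`, with basis
`t_w = Finsupp.single w 1`, given by `t_x t_y = ∑_z γ̃_{x,y,z⁻¹} t_z`. -/
noncomputable def jMul : (W →₀ F) →ₗ[F] (W →₀ F) →ₗ[F] (W →₀ F) :=
  Finsupp.basisSingleOne.constr F fun x => Finsupp.basisSingleOne.constr F fun y =>
    ∑ z : W, gammaTilde F ρ x y z⁻¹ • Finsupp.single z 1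

open Classical in
/-- The element `∑_{w ∈ D̃} ñ_w t_w`, where `D̃ = {w | ñ_w ≠ 0}`. -/
noncomputable def jOne : W →₀ F :=
  ∑ w : W with nTilde F ρ w ≠ 0, nTilde F ρ w • Finsupp.single w 1

end JTilde

end IwahoriHecke

open IwahoriHecke

/-! Let `C_w = (c_{w,λ})_λ` be the family of leading matrices at `w`. The map `jRep : t_w ↦ C_w`
identifies `J̃` with the product over `λ` of the matrix algebras `M_{d_λ}(F)`, which is associative
and unital. What makes this work is the orthogonality of the leading coefficients
(`LeadOrthogonality`): it reconstructs any family `X` of matrices as `∑_z (∑_λ f_λ⁻¹ tr(X_λ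
C_{z⁻¹,λ})) C_z` (`sum_trace_smul_leadMatrix`). For `X = C_x C_y` the coefficients are
`γ̃_{x,y,z⁻¹}`, and for `X = 1` they are `ñ_z`. So `jRep` is multiplicative, maps `∑ ñ_w t_w` to
`1`, and is onto; as `∑ d_λ² = |W|`, it is bijective.

The orthogonality is the constant term of the Schur relations for `H_K`, multiplied by `ε^{a_λ +
a_μ}`: balancedness puts every factor in `𝒪`, where the constant term is multiplicative. The Schur
relations need the `ρ^λ` to map `H_K` onto the whole product of matrix algebras
(`exists_sum_smul_repT_eq`). For this, the Gram matrix of `(x, y) ↦ ∑ d_λ tr ρ^λ(T_x T_y)` is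
specialised at `ε^g ↦ 1`, where it becomes `|W|` times a permutation matrix.

It must also be shown that `a_λ` exists, since `Γ` need not be divisible by two. `K` is embedded in
the Hahn series over `ℂ`, with coefficientwise conjugation. There `T_w` and `T_{w⁻¹}` are adjoint
for the form `B = ∑ ρ(T_w)^* ρ(T_w)`, and this displays both `B_{bb}` and `B_{bb}² c_λ` as sums of
terms `z z̄`. Lowest coefficients of such sums cannot cancel, so these orders, and hence that of
`c_λ`, lie in `2Γ` (`exists_orderTop_eq_add_self`). -/

namespace IwahoriHecke

/-! ### Character theory of the finite group: completeness and the regular character -/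

section GroupCharacters

open Representation Module

variable {W : Type*} [Group W]

/-- Transport of a representation along a linear equivalence. -/
def conjRepresentation {V V' : Type*} [AddCommGroup V] [Module ℂ V] [AddCommGroup V'] [Module ℂ V']
    (σ : Representation ℂ W V) (e : V ≃ₗ[ℂ] V') : Representation ℂ W V' where
  toFun g := e.conj (σ g)
  map_one' := by ext; simp
  map_mul' g h := by ext; simp

/-- A representation is equivalent to each of its transports. -/
def equivConjRepresentation {V V' : Type*} [AddCommGroup V] [Module ℂ V] [AddCommGroup V']
    [Module ℂ V'] (σ : Representation ℂ W V) (e : V ≃ₗ[ℂ] V') :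
    σ.Equiv (conjRepresentation σ e) :=
  Representation.Equiv.mk e fun g => by ext; simp [conjRepresentation]

theorem isIrreducible_of_equiv {V V' : Type*} [AddCommGroup V] [Module ℂ V] [AddCommGroup V']
    [Module ℂ V'] {σ : Representation ℂ W V} {σ' : Representation ℂ W V'} (φ : σ.Equiv σ')
    (h : σ.IsIrreducible) : σ'.IsIrreducible := by
  rw [irreducible_iff_isSimpleModule_asModule] at h ⊢
  have e : σ'.asModule ≃ₗ[MonoidAlgebra ℂ W] σ.asModule :=
    LinearEquiv.ofBijective
      (IntertwiningMap.equivLinearMapAsModule σ' σ φ.symm.toIntertwiningMap)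
      φ.symm.toLinearEquiv.bijective
  exact IsSimpleModule.congr e

/-- A subspace stable under the group elements is stable under their linear combinations, hence is a
submodule over the group algebra. -/
theorem isIrreducible_ofModule' (S : Type*) [AddCommGroup S] [Module ℂ S]
    [Module (MonoidAlgebra ℂ W) S] [IsScalarTower ℂ (MonoidAlgebra ℂ W) S]
    [IsSimpleModule (MonoidAlgebra ℂ W) S] : (ofModule' (k := ℂ) (G := W) S).IsIrreducible := by
  have hS : Nontrivial S := IsSimpleModule.nontrivial (MonoidAlgebra ℂ W) S
  obtain ⟨x, hx⟩ := exists_ne (0 : S)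
  have hmem : ∀ (p : Subrepresentation (ofModule' (k := ℂ) (G := W) S)) (a : MonoidAlgebra ℂ W)
      (v : S), v ∈ p.toSubmodule → a • v ∈ p.toSubmodule := by
    intro p a v hv
    induction a using MonoidAlgebra.induction_linear with
    | zero => rw [zero_smul]; exact Submodule.zero_mem _
    | add a b ha hb => rw [add_smul]; exact Submodule.add_mem _ ha hb
    | single g c =>
      have h1 : (MonoidAlgebra.single g c : MonoidAlgebra ℂ W) • v =
          c • ofModule' (k := ℂ) (G := W) S g v := by
        change _ = c • ((MonoidAlgebra.single g 1 : MonoidAlgebra ℂ W) • v)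
        rw [← smul_assoc, MonoidAlgebra.smul_single, smul_eq_mul, mul_one]
      rw [h1]
      exact Submodule.smul_mem _ _ (p.apply_mem_toSubmodule g hv)
  refine { exists_pair_ne := ⟨⊥, ⊤, fun h => hx ?_⟩, eq_bot_or_eq_top := fun p => ?_ }
  · have h1 : x ∈ (⊥ : Subrepresentation (ofModule' (k := ℂ) (G := W) S)).toSubmodule := by
      rw [h]; exact Submodule.mem_top
    exact (Submodule.mem_bot ℂ).mp h1
  · let q : Submodule (MonoidAlgebra ℂ W) S :=
      { p.toSubmodule with smul_mem' := hmem p }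
    rcases eq_bot_or_eq_top q with h | h
    · left
      refine SetLike.ext fun v => ?_
      change v ∈ q ↔ v ∈ (⊥ : Submodule ℂ S)
      rw [h, Submodule.mem_bot, Submodule.mem_bot]
    · right
      refine SetLike.ext fun v => ?_
      change v ∈ q ↔ v ∈ (⊤ : Submodule ℂ S)
      rw [h]
      exact iff_of_true Submodule.mem_top Submodule.mem_top

variable [Fintype W] {Λ : Type*} {d : Λ → ℕ} {E : ∀ l, Representation ℂ W (Fin (d l) → ℂ)}

/-- A class function orthogonal to all irreducible characters acts as zero on every irreducible
representation. -/
theorem sum_smul_eq_zero_of_isIrreducible (hE : IsCompleteIrr E) {D : W → ℂ}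
    (hD : ∀ g h, D (h * g * h⁻¹) = D g) (hDE : ∀ l, ∑ g, D g * (E l).character g = 0)
    {V : Type*} [AddCommGroup V] [Module ℂ V] [FiniteDimensional ℂ V]
    (σ : Representation ℂ W V) (hσ : σ.IsIrreducible) : ∑ g, D g • σ g = 0 := by
  have hn : Nontrivial V := by
    by_contra hV
    rw [not_nontrivial_iff_subsingleton] at hV
    exact bot_ne_top (α := Subrepresentation σ) (SetLike.ext fun x => by
      rw [Subsingleton.elim x 0]
      exact iff_of_true (Submodule.zero_mem _) (Submodule.zero_mem _))
  -- Completeness speaks of coordinate spaces only, so `σ` is first transported along a basis.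
  obtain ⟨l, ⟨φ⟩⟩ := hE.surjective _ (conjRepresentation σ (finBasis ℂ V).equivFun)
    (isIrreducible_of_equiv (equivConjRepresentation σ _) hσ)
  have hchar := char_iso ((equivConjRepresentation σ _).trans φ)
  have hcomm : ∀ h, (∑ g, D g • σ g) ∘ₗ σ h = σ h ∘ₗ (∑ g, D g • σ g) := by
    intro h
    change (∑ g, D g • σ g) * σ h = σ h * (∑ g, D g • σ g)
    rw [Finset.sum_mul, Finset.mul_sum]
    refine Fintype.sum_equiv (MulAut.conj h⁻¹).toEquiv _ _ fun g => ?_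
    have := hD g h⁻¹
    simp only [inv_inv] at this
    simp only [MulEquiv.toEquiv_eq_coe, MulEquiv.coe_toEquiv, MulAut.conj_apply, inv_inv, this,
      smul_mul_assoc, mul_smul_comm, ← map_mul]
    congr 2
    group
  -- By Schur's lemma the operator is a scalar `c`; its trace is `c dim V` on one side and the
  -- vanishing pairing of `D` with a character on the other.
  obtain ⟨c, hc⟩ := (IsIrreducible.algebraMap_intertwiningMap_bijective_of_isAlgClosed
    (ρ := σ)).2 ⟨_, hcomm⟩
  have hc' : ∑ g, D g • σ g = c • (1 : End ℂ V) := by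
    have := congrArg IntertwiningMap.toLinearMap hc
    exact this.symm
  have htr := congrArg (LinearMap.trace ℂ V) hc'
  simp only [map_sum, map_smul, LinearMap.trace_one, smul_eq_mul] at htr
  have h0 := hDE l
  simp only [← hchar] at h0
  rw [show ∑ g, D g * LinearMap.trace ℂ V (σ g) = 0 from h0] at htr
  have hc0 : c = 0 := by
    rcases mul_eq_zero.mp htr.symm with h | h
    · exact h
    · exact absurd (Nat.cast_eq_zero.mp h) (finrank_pos (R := ℂ) (M := V)).ne'
  rw [hc', hc0, zero_smul]

/-- A class function orthogonal to all irreducible characters acts as zero on every simple module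
over the group algebra. -/
theorem sum_single_smul_eq_zero (hE : IsCompleteIrr E) {D : W → ℂ}
    (hD : ∀ g h, D (h * g * h⁻¹) = D g) (hDE : ∀ l, ∑ g, D g * (E l).character g = 0)
    (S : Type*) [AddCommGroup S] [Module ℂ S] [Module (MonoidAlgebra ℂ W) S]
    [IsScalarTower ℂ (MonoidAlgebra ℂ W) S] [IsSimpleModule (MonoidAlgebra ℂ W) S] (x : S) :
    (∑ g, MonoidAlgebra.single g (D g) : MonoidAlgebra ℂ W) • x = 0 := by
  have : FiniteDimensional ℂ S := Module.Finite.trans (MonoidAlgebra ℂ W) S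
  have h0 := sum_smul_eq_zero_of_isIrreducible hE hD hDE _ (isIrreducible_ofModule' S)
  have h1 := LinearMap.congr_fun h0 x
  rw [LinearMap.sum_apply] at h1
  rw [Finset.sum_smul, ← LinearMap.zero_apply (σ₁₂ := RingHom.id ℂ) x, ← h1]
  refine Finset.sum_congr rfl fun g _ => ?_
  change _ = D g • ((MonoidAlgebra.single g 1 : MonoidAlgebra ℂ W) • x)
  rw [← smul_assoc, MonoidAlgebra.smul_single, smul_eq_mul, mul_one]

/-- A class function orthogonal to all irreducible characters vanishes. -/
theorem classFunction_eq_zero (hE : IsCompleteIrr E) {D : W → ℂ}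
    (hD : ∀ g h, D (h * g * h⁻¹) = D g) (hDE : ∀ l, ∑ g, D g * (E l).character g = 0) :
    D = 0 := by
  classical
  set e : MonoidAlgebra ℂ W := ∑ g, MonoidAlgebra.single g (D g) with he
  have hcomm : ∀ x : MonoidAlgebra ℂ W, x * e = e * x := by
    intro x
    induction x using MonoidAlgebra.induction_linear with
    | zero => simp
    | add x y hx hy => rw [add_mul, mul_add, hx, hy]
    | single h a =>
      rw [he, Finset.sum_mul, Finset.mul_sum]
      refine Fintype.sum_equiv (MulAut.conj h).toEquiv _ _ fun g => ?_
      simp only [MulEquiv.toEquiv_eq_coe, MulEquiv.coe_toEquiv, MulAut.conj_apply, hD,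
        MonoidAlgebra.single_mul_single, mul_comm a]
      congr 1
      group
  -- By Maschke the group algebra is the sum of its simple submodules. The central element `e` kills
  -- each of them, hence also `1`.
  have key : (⊤ : Submodule (MonoidAlgebra ℂ W) (MonoidAlgebra ℂ W)) ≤
      LinearMap.ker (LinearMap.toSpanSingleton (MonoidAlgebra ℂ W) (MonoidAlgebra ℂ W) e) := by
    rw [← IsSemisimpleModule.sSup_simples_eq_top]
    refine sSup_le fun S hS x hx => ?_
    have hS : IsSimpleModule (MonoidAlgebra ℂ W) S := hS
    have h1 := sum_single_smul_eq_zero hE hD hDE S ⟨x, hx⟩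
    rw [LinearMap.mem_ker, LinearMap.toSpanSingleton_apply, smul_eq_mul, hcomm]
    exact congrArg Subtype.val h1
  have he0 : e = 0 := by
    have := key (Submodule.mem_top (x := 1))
    simpa using this
  funext g
  have := congrArg (fun x : MonoidAlgebra ℂ W => x.coeff g) he0
  simpa [he, Finsupp.single_apply] using this

theorem sum_character_mul_character_inv (hE : IsCompleteIrr E) [DecidableEq Λ] (l m : Λ) :
    ∑ g, (E l).character g * (E m).character g⁻¹ = if l = m then (Fintype.card W : ℂ) else 0 := by
  classical
  have := hE.irreducible l
  have := hE.irreducible m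
  have hcard : (Nat.card W : ℂ) ≠ 0 := by simp
  have : Invertible (Nat.card W : ℂ) := invertibleOfNonzero hcard
  have h := char_orthonormal (E l) (E m)
  have hiff : Nonempty ((E m).Equiv (E l)) ↔ l = m := by
    refine ⟨fun h => (hE.injective _ _ h).symm, ?_⟩
    rintro rfl
    exact ⟨.refl _⟩
  simp only [hiff] at h
  rw [inv_mul_eq_iff_eq_mul₀ hcard] at h
  rw [h, Nat.card_eq_fintype_card]
  split_ifs <;> simp

variable [Fintype Λ]

/-- The decomposition of the regular character. -/
theorem sum_dim_mul_character (hE : IsCompleteIrr E) [DecidableEq W] (g : W) :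
    ∑ l, (d l : ℂ) * (E l).character g = if g = 1 then (Fintype.card W : ℂ) else 0 := by
  classical
  have key := classFunction_eq_zero hE
    (D := fun g => (∑ l, (d l : ℂ) * (E l).character g⁻¹) -
      if g = 1 then (Fintype.card W : ℂ) else 0) ?_ ?_
  · have := congrFun key g⁻¹
    simpa [sub_eq_zero] using this
  · intro g h
    have h1 : (h * g * h⁻¹)⁻¹ = h * g⁻¹ * h⁻¹ := by group
    simp only [h1, char_conj, conj_eq_one_iff]
  · intro m
    simp only [sub_mul, Finset.sum_sub_distrib, Finset.sum_mul]
    rw [Finset.sum_comm]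
    have h1 : ∀ l, ∑ g, (d l : ℂ) * (E l).character g⁻¹ * (E m).character g =
        if m = l then (d l : ℂ) * Fintype.card W else 0 := by
      intro l
      have := sum_character_mul_character_inv hE m l
      simp only [mul_assoc, ← Finset.mul_sum, mul_comm ((E l).character _), this, mul_ite, mul_zero]
    simp only [h1]
    simp [mul_comm]

end GroupCharacters

/-! ### The Hecke algebra: right multiplication, Casimir identity, specialisation to the group
algebra -/

section Hecke

variable {B W : Type*} [Group W] {M : CoxeterMatrix B} {cs : CoxeterSystem M W}
  {Γ : Type*} [AddCommGroup Γ] (L : WeightFunction cs Γ) (R : Type*) [CommRing R]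

namespace HeckeAlgebra

theorem mul_T_simple (x : HeckeAlgebra L R) (i : B) :
    x * T L R (cs.simple i) = rightOp L R i x := by
  have h : T L R (cs.simple i) = rightOp L R i (T L R 1) := by
    rw [rightOp_T]; simp
  rw [mul_eq_lmul, h, ← Module.End.mul_apply, (commute_lmul_rightOp L R x i).eq,
    Module.End.mul_apply, lmul_apply_one]

open Classical in
theorem T_mul_T_simple (w : W) (i : B) : T L R w * T L R (cs.simple i) =
    T L R (w * cs.simple i) +
      (if cs.length w < cs.length (w * cs.simple i) then 0 else heckeParam L R i) • T L R w := by
  rw [mul_T_simple, rightOp_T]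
  split_ifs <;> simp

open Classical in
theorem T_simple_mul_T_eq_add (i : B) (w : W) : T L R (cs.simple i) * T L R w =
    T L R (cs.simple i * w) +
      (if cs.length w < cs.length (cs.simple i * w) then 0 else heckeParam L R i) • T L R w := by
  rw [T_simple_mul_T]
  split_ifs <;> simp

theorem T_simple_mul_T_of_lt {i : B} {w : W} (h : cs.length w < cs.length (cs.simple i * w)) :
    T L R (cs.simple i) * T L R w = T L R (cs.simple i * w) := by
  rw [T_simple_mul_T, if_pos h]

variable (cs) in
/-- Induction along reduced words. -/
theorem simple_mul_induction {p : W → Prop} (one : p 1)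
    (simple_mul : ∀ i w, cs.length w < cs.length (cs.simple i * w) → p w → p (cs.simple i * w))
    (w : W) : p w := by
  obtain ⟨ω, hω, rfl⟩ := cs.exists_isReduced w
  induction ω with
  | nil => simpa using one
  | cons i ω ih =>
    have h1 : cs.IsReduced ω := by simpa using hω.drop 1
    rw [cs.wordProd_cons]
    refine simple_mul i _ ?_ (ih h1)
    have := hω.eq
    rw [cs.wordProd_cons, List.length_cons] at this
    rw [this, h1.eq]
    simp

/-- The Casimir identity for the dual bases `T_w` and `T_{w⁻¹}`. -/
theorem sum_T_simple_mul [Fintype W] {N : Type*} [AddCommGroup N] [Module (AddMonoidAlgebra R Γ) N]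
    (f : HeckeAlgebra L R →ₗ[AddMonoidAlgebra R Γ] HeckeAlgebra L R →ₗ[AddMonoidAlgebra R Γ] N)
    (i : B) : ∑ w : W, f (T L R (cs.simple i) * T L R w) (T L R w⁻¹) =
      ∑ w : W, f (T L R w) (T L R w⁻¹ * T L R (cs.simple i)) := by
  simp only [T_simple_mul_T_eq_add, T_mul_T_simple, map_add, LinearMap.add_apply, map_smul,
    LinearMap.smul_apply, Finset.sum_add_distrib]
  -- The terms `T_{sw} ⊗ T_{w⁻¹}` match after `w ↦ sw`; the parameter terms match one by one,
  -- because `ℓ(w⁻¹s) = ℓ(sw)`.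
  congr 1
  · refine Fintype.sum_equiv (Equiv.mulLeft (cs.simple i)) _ _ fun w => ?_
    simp [mul_assoc]
  · refine Finset.sum_congr rfl fun w _ => ?_
    have h : cs.length (w⁻¹ * cs.simple i) = cs.length (cs.simple i * w) := by
      rw [← cs.length_inv (cs.simple i * w)]; simp
    rw [h, cs.length_inv]

section Specialization

variable [Fintype W] {R} (θ : AddMonoidAlgebra R Γ →+* ℂ) (χ : W → ℂ)

/-- The linear form on the Hecke algebra with `T_w ↦ χ w`, semilinear along a specialisation of
the ground ring. -/
noncomputable def specForm : HeckeAlgebra L R →ₛₗ[θ] ℂ where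
  toFun h := ∑ w, θ ((basis L R).repr h w) * χ w
  map_add' x y := by simp [add_mul, Finset.sum_add_distrib]
  map_smul' a x := by simp [Finset.mul_sum, mul_assoc]

theorem specForm_T (w : W) : specForm L θ χ (T L R w) = χ w := by
  classical
  change ∑ u, θ ((basis L R).repr (basis L R w) u) * χ u = χ w
  rw [Finset.sum_eq_single w]
  · simp
  · intro u _ hu
    simp [hu.symm]
  · simp

variable {θ} in
-- Once the parameters vanish, `T_s` permutes the basis by left translation, which can be absorbed
-- into `χ`. For this `χ` has to be an arbitrary function, and the induction for `specForm_T_mul_T`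
-- varies it.
theorem specForm_T_simple_mul (hθ : ∀ i, θ (heckeParam L R i) = 0) (i : B)
    (h : HeckeAlgebra L R) : specForm L θ χ (T L R (cs.simple i) * h) =
      specForm L θ (fun w => χ (cs.simple i * w)) h := by
  have : (specForm L θ χ).comp (LinearMap.mulLeft (AddMonoidAlgebra R Γ) (T L R (cs.simple i))) =
      specForm L θ (fun w => χ (cs.simple i * w)) := by
    refine (basis L R).ext fun w => ?_
    change specForm L θ χ (T L R (cs.simple i) * T L R w) = specForm L θ _ (T L R w)
    rw [T_simple_mul_T_eq_add, map_add, LinearMap.map_smulₛₗ, specForm_T, specForm_T, specForm_T]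
    split_ifs <;> simp [hθ]
  exact LinearMap.congr_fun this h

variable {θ} in
/-- Under a specialisation that kills the parameters, the Hecke algebra becomes the group
algebra. -/
theorem specForm_T_mul_T (hθ : ∀ i, θ (heckeParam L R i) = 0) (x y : W) :
    specForm L θ χ (T L R x * T L R y) = χ (x * y) := by
  induction x using simple_mul_induction cs generalizing χ with
  | one => rw [← one_eq_T, one_mul, specForm_T, one_mul]
  | simple_mul i w hw ih =>
    rw [← T_simple_mul_T_of_lt L R hw, mul_assoc, specForm_T_simple_mul L χ hθ, ih, mul_assoc]

end Specialization

end HeckeAlgebra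

end Hecke

/-! ### Joint surjectivity of the representations and the Schur relations -/

section SchurRelations

open HeckeAlgebra Matrix
open scoped TensorProduct

variable {B W : Type*} [Group W] {M : CoxeterMatrix B} {cs : CoxeterSystem M W}
  {Γ : Type*} [AddCommGroup Γ] {L : WeightFunction cs Γ} {R : Type*} [CommRing R]
  {K : Type*} [Field K] [Algebra (AddMonoidAlgebra R Γ) K]

/-- The restriction to `H` of a matrix representation of `H_K`. -/
noncomputable def repH {d : ℕ} (ρ : MatrixRep L R K d) :
    HeckeAlgebra L R →ₐ[AddMonoidAlgebra R Γ] Matrix (Fin d) (Fin d) K :=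
  (ρ.restrictScalars (AddMonoidAlgebra R Γ)).comp Algebra.TensorProduct.includeRight

theorem repH_T {d : ℕ} (ρ : MatrixRep L R K d) (w : W) : repH ρ (T L R w) = repT ρ w := rfl

theorem repT_one {d : ℕ} (ρ : MatrixRep L R K d) : repT ρ (1 : W) = 1 := by
  rw [← repH_T, ← one_eq_T, map_one]

variable [Fintype W]

/-- The averaging operator intertwines the two representations. -/
theorem repT_mul_sum {d e : ℕ} (ρ : MatrixRep L R K d) (σ : MatrixRep L R K e)
    (φ : Matrix (Fin d) (Fin e) K) (x : W) :
    repT ρ x * ∑ w : W, repT ρ w * φ * repT σ w⁻¹ =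
      (∑ w : W, repT ρ w * φ * repT σ w⁻¹) * repT σ x := by
  induction x using simple_mul_induction cs with
  | one => simp [repT_one]
  | simple_mul i w hw ih =>
    have hs : repT ρ (cs.simple i) * ∑ w : W, repT ρ w * φ * repT σ w⁻¹ =
        (∑ w : W, repT ρ w * φ * repT σ w⁻¹) * repT σ (cs.simple i) := by
      -- The Casimir identity is applied to the bilinear map `(x, y) ↦ ρ(x) φ σ(y)`.
      have h := sum_T_simple_mul L R (LinearMap.mk₂ (AddMonoidAlgebra R Γ)
        (fun x y => repH ρ x * φ * repH σ y)
        (fun x y z => by simp [Matrix.add_mul]) (fun a x y => by simp)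
        (fun x y z => by simp [Matrix.mul_add]) (fun a x y => by simp)) i
      simpa only [LinearMap.mk₂_apply, map_mul, repH_T, Matrix.mul_sum, Matrix.sum_mul,
        Matrix.mul_assoc] using h
    have hm : ∀ {d : ℕ} (ρ : MatrixRep L R K d), repT ρ (cs.simple i * w) =
        repT ρ (cs.simple i) * repT ρ w := by
      intro d ρ
      rw [← repH_T, ← T_simple_mul_T_of_lt L R hw, map_mul, repH_T, repH_T]
    rw [hm, hm, Matrix.mul_assoc, ih, ← Matrix.mul_assoc, hs, Matrix.mul_assoc]

variable {Λ : Type*} {d : Λ → ℕ} (ρ : ∀ l, MatrixRep L R K (d l))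

theorem sum_smul_repT_mul_sum {l m : Λ} (φ : Matrix (Fin (d l)) (Fin (d m)) K) (k : W → K) :
    (∑ x, k x • repT (ρ l) x) * ∑ w : W, repT (ρ l) w * φ * repT (ρ m) w⁻¹ =
      (∑ w : W, repT (ρ l) w * φ * repT (ρ m) w⁻¹) * ∑ x, k x • repT (ρ m) x := by
  rw [Matrix.sum_mul, Matrix.mul_sum]
  simp only [Matrix.smul_mul, Matrix.mul_smul, repT_mul_sum]

theorem trace_repH {d : ℕ} (ρ : MatrixRep L R K d) {a : W → AddMonoidAlgebra R Γ}
    (ha : ∀ w, algebraMap _ K (a w) = (repT ρ w).trace) (h : HeckeAlgebra L R) :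
    (repH ρ h).trace = algebraMap _ K (∑ w, (basis L R).repr h w * a w) := by
  conv_lhs => rw [← (basis L R).sum_repr h]
  rw [map_sum, map_sum, Matrix.trace_sum]
  refine Finset.sum_congr rfl fun w _ => ?_
  rw [map_smul, Matrix.trace_smul, map_mul, ha, Algebra.smul_def]
  rfl

theorem sum_mul_single_mul_apply {d e : ℕ} (ρ : MatrixRep L R K d) (σ : MatrixRep L R K e)
    (i j : Fin d) (k n : Fin e) :
    (∑ w : W, repT ρ w * Matrix.single j k (1 : K) * repT σ w⁻¹) i n =
      ∑ w : W, repT ρ w i j * repT σ w⁻¹ k n := by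
  rw [Matrix.sum_apply]
  refine Finset.sum_congr rfl fun w _ => ?_
  rw [Matrix.mul_assoc, Matrix.mul_apply, Finset.sum_eq_single j]
  · rw [Matrix.single_mul_apply_same, one_mul]
  · intro b _ hb
    rw [Matrix.single_mul_apply_of_ne _ _ _ _ _ hb, mul_zero]
  · simp

variable {ρ} in
-- Some element of `H_K` acts as `1` in `ρ^l` and as `0` in `ρ^m`, so the averaging operator, which
-- intertwines them, is zero. The sum is an entry of the average of an elementary matrix.
theorem schur_relation_of_ne (hsurj : ∀ X : ∀ l, Matrix (Fin (d l)) (Fin (d l)) K,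
      ∃ k : W → K, ∀ l, ∑ x, k x • repT (ρ l) x = X l) {l m : Λ} (hlm : l ≠ m)
    (i j : Fin (d l)) (k n : Fin (d m)) :
    ∑ w : W, repT (ρ l) w i j * repT (ρ m) w⁻¹ k n = 0 := by
  classical
  obtain ⟨c, hc⟩ := hsurj (Pi.single l 1)
  have h := sum_smul_repT_mul_sum ρ (Matrix.single j k (1 : K)) c
  rw [hc, hc, Pi.single_eq_same, Pi.single_eq_of_ne hlm.symm, Matrix.one_mul, Matrix.mul_zero] at h
  rw [← sum_mul_single_mul_apply, h, Matrix.zero_apply]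

variable {ρ} in
-- The average of an elementary matrix commutes with all matrices, so it is scalar; this gives the
-- condition `i = n`. The symmetry `w ↦ w⁻¹` exchanges the two index pairs and gives `j = k`. The
-- remaining constant is found by taking traces.
theorem schur_relation_self [CharZero K] (hsurj : ∀ X : ∀ l, Matrix (Fin (d l)) (Fin (d l)) K,
      ∃ k : W → K, ∀ l, ∑ x, k x • repT (ρ l) x = X l) (l : Λ) (i j k n : Fin (d l)) :
    ∑ w : W, repT (ρ l) w i j * repT (ρ l) w⁻¹ k n =
      if i = n ∧ j = k then schurElement (ρ l) else 0 := by
  classical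
  set S : Fin (d l) → Fin (d l) → Fin (d l) → Fin (d l) → K := fun i j k n =>
    ∑ w : W, repT (ρ l) w i j * repT (ρ l) w⁻¹ k n
  have hsymm : ∀ i j k n, S i j k n = S k n i j := by
    intro i j k n
    refine Fintype.sum_equiv (Equiv.inv W) _ _ fun w => ?_
    simp [mul_comm]
  -- Scalarity is read off entrywise, by commuting with the elementary matrix `E_{ib}`.
  have hcomm : ∀ i b j k n, S b j k n = if b = n then S i j k i else 0 := by
    intro i b j k n
    obtain ⟨c, hc⟩ := hsurj (Pi.single l (Matrix.single i b 1))
    have h := sum_smul_repT_mul_sum ρ (Matrix.single j k (1 : K)) c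
    rw [hc, Pi.single_eq_same] at h
    have h1 := congrFun (congrFun h i) n
    rw [Matrix.single_mul_apply_same, one_mul, sum_mul_single_mul_apply] at h1
    change S b j k n = _ at h1
    rw [h1]
    split_ifs with hb
    · subst hb
      rw [Matrix.mul_single_apply_same, mul_one, sum_mul_single_mul_apply]
    · rw [Matrix.mul_single_apply_of_ne _ _ _ _ _ (Ne.symm hb)]
  have hconst : ∀ i j b, S i j j i = S b b b b := by
    intro i j b
    rw [hcomm b i j j i, if_pos rfl, hsymm, hcomm b j b b j, if_pos rfl]
  have hschur : ∀ b, schurElement (ρ l) = S b b b b := by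
    intro b
    have hd : (d l : K) ≠ 0 := Nat.cast_ne_zero.mpr (Nat.ne_zero_of_lt b.pos)
    rw [schurElement, inv_mul_eq_iff_eq_mul₀ hd]
    simp only [Matrix.trace, Matrix.diag_apply, Finset.sum_mul_sum]
    rw [Finset.sum_comm]
    have : ∀ i, ∑ w : W, ∑ j, repT (ρ l) w i i * repT (ρ l) w⁻¹ j j = S b b b b := by
      intro i
      rw [Finset.sum_comm, Finset.sum_eq_single i]
      · exact hconst i i b
      · intro j _ hj
        change S i i j j = 0
        rw [hcomm i, if_neg hj.symm]
      · simp
    simp [this]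
  change S i j k n = _
  rw [hcomm i, hschur i]
  by_cases h1 : i = n
  · by_cases h2 : j = k
    · subst h2
      simp [h1, hconst n j n]
    · have h0 : S i j k i = 0 := by rw [hsymm, hcomm k, if_neg (Ne.symm h2)]
      simp [h0, h2]
  · simp [h1]

variable [Fintype Λ]

/-- Families of representations whose characters specialise to the irreducible characters of `W`
are jointly faithful. -/
theorem eq_zero_of_sum_smul_repT_eq_zero [FaithfulSMul (AddMonoidAlgebra R Γ) K]
    {θ : AddMonoidAlgebra R Γ →+* ℂ}
    (hθ : ∀ i, θ (heckeParam L R i) = 0) {E : ∀ l, Representation ℂ W (Fin (d l) → ℂ)}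
    (hE : IsCompleteIrr E) {a : Λ → W → AddMonoidAlgebra R Γ}
    (ha : ∀ l w, algebraMap _ K (a l w) = (repT (ρ l) w).trace)
    (haE : ∀ l w, θ (a l w) = (E l).character w) {k : W → K}
    (hk : ∀ l, ∑ x, k x • repT (ρ l) x = 0) : k = 0 := by
  classical
  -- The Gram matrix of the form `(x, y) ↦ ∑ d_l tr ρ^l(T_x T_y)`, with entries kept in `R[Γ]` so
  -- that it can be specialised.
  let G : Matrix W W (AddMonoidAlgebra R Γ) := fun x y =>
    ∑ l, (d l : AddMonoidAlgebra R Γ) * ∑ w, (basis L R).repr (T L R x * T L R y) w * a l w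
  -- The specialised form is the regular character at `xy`, which is supported on `y = x⁻¹`.
  have hG : G.map θ = (Fintype.card W : ℂ) • (Equiv.inv W).toPEquiv.toMatrix := by
    ext x y
    have h1 : ∀ l, θ (∑ w, (basis L R).repr (T L R x * T L R y) w * a l w) =
        (E l).character (x * y) := by
      intro l
      rw [← specForm_T_mul_T L (E l).character hθ, map_sum]
      simp only [map_mul, haE]
      rfl
    have h2 : G.map θ x y = ∑ l, (d l : ℂ) * (E l).character (x * y) := by
      rw [Matrix.map_apply, ← Finset.sum_congr rfl fun l _ => congrArg _ (h1 l)]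
      change θ (∑ l, _) = _
      simp only [map_sum, map_mul, map_natCast]
    simp only [h2, Matrix.smul_apply, smul_eq_mul, sum_dim_mul_character hE, PEquiv.toMatrix_apply, Equiv.toPEquiv_apply,
      Option.mem_def, Option.some_inj, Equiv.inv_apply, mul_eq_one_iff_inv_eq, mul_ite, mul_one,
      mul_zero]
  have hdetθ : (G.map θ).det ≠ 0 := by
    rw [hG, Matrix.det_smul, Matrix.det_permutation]
    simp
  have hdet : (G.map (algebraMap (AddMonoidAlgebra R Γ) K)).det ≠ 0 := by
    intro h
    rw [← RingHom.mapMatrix_apply, ← RingHom.map_det] at h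
    have h2 : G.det = 0 :=
      (map_eq_zero_iff _ (FaithfulSMul.algebraMap_injective (AddMonoidAlgebra R Γ) K)).mp h
    apply hdetθ
    rw [← RingHom.mapMatrix_apply, ← RingHom.map_det, h2, map_zero]
  -- An element acting as zero in every `ρ^l` lies in the radical of this non-degenerate form.
  refine Matrix.eq_zero_of_vecMul_eq_zero hdet ?_
  funext y
  have hG' : ∀ x, algebraMap _ K (G x y) =
      ∑ l, (d l : K) * (repT (ρ l) x * repT (ρ l) y).trace := by
    intro x
    simp only [G, map_sum, map_mul, map_natCast]
    refine Finset.sum_congr rfl fun l _ => ?_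
    rw [← repH_T, ← repH_T, ← map_mul, trace_repH (ρ l) (ha l)]
    simp only [map_sum, map_mul]
  simp only [Matrix.vecMul, dotProduct, Matrix.map_apply, hG', Finset.mul_sum, Pi.zero_apply]
  rw [Finset.sum_comm]
  refine Finset.sum_eq_zero fun l _ => ?_
  have := congrArg (fun X => (d l : K) * (X * repT (ρ l) y).trace) (hk l)
  simp only [Finset.sum_mul, Matrix.smul_mul, Matrix.trace_sum, Matrix.trace_smul, Matrix.zero_mul,
    Matrix.trace_zero, mul_zero, Finset.mul_sum, smul_eq_mul] at this
  rw [← this]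
  exact Finset.sum_congr rfl fun x _ => by ring

theorem sum_dim_sq {E : ∀ l, Representation ℂ W (Fin (d l) → ℂ)} (hE : IsCompleteIrr E) :
    ∑ l, d l * d l = Fintype.card W := by
  classical
  have h := sum_dim_mul_character hE 1
  simp only [Representation.char_one, Module.finrank_fin_fun, if_true] at h
  exact_mod_cast h

/-- Joint faithfulness makes the map from `K^W` to the product of matrix algebras injective, and `∑
d_l² = |W|` equates the dimensions. -/
theorem exists_sum_smul_repT_eq [FaithfulSMul (AddMonoidAlgebra R Γ) K]
    {θ : AddMonoidAlgebra R Γ →+* ℂ}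
    (hθ : ∀ i, θ (heckeParam L R i) = 0) {E : ∀ l, Representation ℂ W (Fin (d l) → ℂ)}
    (hE : IsCompleteIrr E) {a : Λ → W → AddMonoidAlgebra R Γ}
    (ha : ∀ l w, algebraMap _ K (a l w) = (repT (ρ l) w).trace)
    (haE : ∀ l w, θ (a l w) = (E l).character w) (X : ∀ l, Matrix (Fin (d l)) (Fin (d l)) K) :
    ∃ k : W → K, ∀ l, ∑ x, k x • repT (ρ l) x = X l := by
  classical
  let Φ : (W → K) →ₗ[K] ∀ l, Matrix (Fin (d l)) (Fin (d l)) K :=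
    Fintype.linearCombination K fun x l => repT (ρ l) x
  have hΦ : ∀ k l, Φ k l = ∑ x, k x • repT (ρ l) x := by
    intro k l
    simp [Φ, Fintype.linearCombination_apply, Finset.sum_apply]
  have hinj : Function.Injective Φ := by
    rw [injective_iff_map_eq_zero]
    intro k hk
    refine eq_zero_of_sum_smul_repT_eq_zero ρ hθ hE ha haE fun l => ?_
    rw [← hΦ, hk, Pi.zero_apply]
  have hfr : Module.finrank K (W → K) =
      Module.finrank K (∀ l, Matrix (Fin (d l)) (Fin (d l)) K) := by
    rw [Module.finrank_fintype_fun_eq_card, Module.finrank_pi_fintype, ← sum_dim_sq hE]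
    simp [Module.finrank_matrix]
  obtain ⟨k, hk⟩ := (LinearMap.injective_iff_surjective_of_finrank_eq_finrank hfr).mp hinj X
  exact ⟨k, fun l => by rw [← hΦ, hk]⟩

end SchurRelations

/-! ### Embedding `K` in Hahn series: orders, constant terms, lowest terms -/

section HahnEmbedding

/-- A non-zero element of `F[Γ]` has a lowest term. -/
theorem exists_lowest_term {Γ F : Type*} [LinearOrder Γ] [Semiring F]
    {p : AddMonoidAlgebra F Γ} (hp : p ≠ 0) :
    ∃ (g : Γ) (r : F) (q : AddMonoidAlgebra F Γ), r ≠ 0 ∧ (∀ h ∈ q.coeff.support, g < h) ∧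
      p = AddMonoidAlgebra.single g r + q ∧ g ∈ p.coeff.support := by
  classical
  have hne : p.coeff.support.Nonempty := by
    rw [Finsupp.support_nonempty_iff]
    exact fun h => hp (AddMonoidAlgebra.coeff_injective h)
  have hmem := Finset.min'_mem _ hne
  refine ⟨p.coeff.support.min' hne, p.coeff _, p.erase _, Finsupp.mem_support_iff.mp hmem, ?_,
    (AddMonoidAlgebra.single_add_erase _ p).symm, hmem⟩
  intro h hh
  rw [AddMonoidAlgebra.coeff_erase, Finsupp.support_erase, Finset.mem_erase] at hh
  exact lt_of_le_of_ne (Finset.min'_le _ _ hh.2) hh.1.symm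

variable {Γ : Type*} [AddCommGroup Γ] [LinearOrder Γ] [IsOrderedAddMonoid Γ]

/-- The homomorphism from `S[Γ]` to Hahn series induced by a homomorphism of coefficients. -/
noncomputable def hahnHom {S : Type*} [CommRing S] (f : S →+* ℂ) :
    AddMonoidAlgebra S Γ →+* HahnSeries Γ ℂ :=
  AddMonoidAlgebra.liftNCRingHom (HahnSeries.C.comp f)
    { toFun := fun g => HahnSeries.single g.toAdd 1
      map_one' := rfl
      map_mul' := fun a b => by simp } fun _ _ => Commute.all _ _

theorem hahnHom_single {S : Type*} [CommRing S] (f : S →+* ℂ) (g : Γ) (r : S) :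
    hahnHom f (AddMonoidAlgebra.single g r) = HahnSeries.single g (f r) := by
  change AddMonoidAlgebra.liftNC _ _ _ = _
  rw [AddMonoidAlgebra.liftNC_single]
  simp

theorem coeff_hahnHom {S : Type*} [CommRing S] (f : S →+* ℂ) (p : AddMonoidAlgebra S Γ) (g : Γ) :
    (hahnHom f p).coeff g = f (p.coeff g) := by
  classical
  induction p using AddMonoidAlgebra.induction_linear with
  | zero => simp
  | add p q hp hq => simp [hp, hq]
  | single h r =>
    rw [hahnHom_single, HahnSeries.coeff_single, AddMonoidAlgebra.coeff_single, Finsupp.single_apply]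
    simp only [eq_comm]
    split_ifs <;> simp

theorem hahnHom_injective {S : Type*} [CommRing S] {f : S →+* ℂ} (hf : Function.Injective f) :
    Function.Injective (hahnHom (Γ := Γ) f) := by
  intro p q h
  refine AddMonoidAlgebra.coeff_injective (Finsupp.ext fun g => hf ?_)
  rw [← coeff_hahnHom, h, coeff_hahnHom]

variable (R : Subring ℂ) (F : Type*) [Field F] [Algebra R F] [IsFractionRing R F]
  (K : Type*) [Field K] [Algebra (AddMonoidAlgebra R Γ) K]
  [IsFractionRing (AddMonoidAlgebra R Γ) K]

/-- The inclusion of `F = Frac R` in `ℂ`. -/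
noncomputable def complexHom : F →+* ℂ :=
  IsFractionRing.lift (g := R.subtype) Subtype.val_injective

theorem complexHom_algebraMap (r : R) : complexHom R F (algebraMap R F r) = r :=
  IsFractionRing.lift_algebraMap _ _

/-- The embedding of `K = Frac R[Γ]` in the field of Hahn series. -/
noncomputable def hahnEmb : K →+* HahnSeries Γ ℂ :=
  IsFractionRing.lift (hahnHom_injective (Γ := Γ) (f := R.subtype) Subtype.val_injective)

theorem hahnEmb_algebraMap (p : AddMonoidAlgebra R Γ) :
    hahnEmb R K (algebraMap (AddMonoidAlgebra R Γ) K p) = hahnHom R.subtype p :=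
  IsFractionRing.lift_algebraMap _ _

theorem hahnEmb_eps (g : Γ) : hahnEmb R K (eps R K g) = HahnSeries.single g 1 := by
  rw [eps, hahnEmb_algebraMap, hahnHom_single]
  simp

theorem hahnEmb_scalarHom (r : F) :
    hahnEmb (Γ := Γ) R K (scalarHom Γ R F K r) = HahnSeries.C (complexHom R F r) := by
  have : (hahnEmb (Γ := Γ) R K).comp (scalarHom Γ R F K) = HahnSeries.C.comp (complexHom R F) := by
    refine IsLocalization.ringHom_ext (nonZeroDivisors R) (RingHom.ext fun r => ?_)
    simp only [RingHom.comp_apply, complexHom_algebraMap]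
    rw [scalarHom, IsFractionRing.lift_algebraMap, RingHom.comp_apply, hahnEmb_algebraMap]
    exact hahnHom_single _ _ _
  exact RingHom.congr_fun this r

variable {R F K} in
theorem laurentHom_single (g : Γ) (r : F) :
    laurentHom R F K (AddMonoidAlgebra.single g r) = scalarHom Γ R F K r * eps R K g := by
  change AddMonoidAlgebra.liftNC _ _ _ = _
  rw [AddMonoidAlgebra.liftNC_single]
  rfl

theorem hahnEmb_laurentHom (p : AddMonoidAlgebra F Γ) :
    hahnEmb R K (laurentHom R F K p) = hahnHom (complexHom R F) p := by
  induction p using AddMonoidAlgebra.induction_linear with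
  | zero => simp
  | add p q hp hq => simp [hp, hq]
  | single g r =>
    rw [laurentHom_single, map_mul, hahnEmb_scalarHom, hahnEmb_eps, hahnHom_single, HahnSeries.C_apply,
      HahnSeries.single_mul_single, zero_add, mul_one]

variable {R F K}

theorem zero_lt_orderTop_hahnHom {p : AddMonoidAlgebra F Γ} (hp : PosSupport p) :
    0 < (hahnHom (complexHom R F) p).orderTop := by
  by_contra h
  have h' : (hahnHom (complexHom R F) p).orderTop < ⊤ :=
    lt_of_le_of_lt (not_lt.mp h) (WithTop.coe_lt_top (0 : Γ))
  obtain ⟨g, hg⟩ := WithTop.ne_top_iff_exists.mp h'.ne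
  have h1 := HahnSeries.coeff_orderTop_ne hg.symm
  rw [coeff_hahnHom] at h1
  have h2 := hp g (Finsupp.mem_support_iff.mpr fun h => h1 (by rw [h, map_zero]))
  rw [← hg] at h
  exact h (by exact_mod_cast h2)

theorem orderTop_hahnHom_one_add {p : AddMonoidAlgebra F Γ} (hp : PosSupport p) :
    (hahnHom (complexHom R F) (1 + p)).orderTop = 0 := by
  refine (HahnSeries.orderTop_self_sub_one_pos_iff _).mp ?_ |>.1
  rw [map_add, map_one, add_sub_cancel_left]
  exact zero_lt_orderTop_hahnHom hp

/-- The factors `1 + p` and `1 + q` have order zero, so only `r ε^g` counts. There is no equality in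
general, since `HasNormalForm` admits `r = 0`, where the order is `⊤`. -/
theorem le_orderTop_of_hasNormalForm {x : K} {r : F} {g : Γ} (h : HasNormalForm R F x r g) :
    (g : WithTop Γ) ≤ (hahnEmb R K x).orderTop := by
  obtain ⟨p, q, hp, hq, rfl⟩ := h
  have hq0 : hahnHom (complexHom R F) (1 + q) ≠ 0 := by
    intro h
    have := orderTop_hahnHom_one_add (R := R) hq
    rw [h, HahnSeries.orderTop_zero] at this
    exact WithTop.top_ne_coe this
  have key : hahnEmb R K (scalarHom Γ R F K r * eps R K g *
      (laurentHom R F K (1 + p) / laurentHom R F K (1 + q))) * hahnHom (complexHom R F) (1 + q) =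
      HahnSeries.single g (complexHom R F r) * hahnHom (complexHom R F) (1 + p) := by
    rw [map_mul, map_mul, map_div₀, hahnEmb_laurentHom, hahnEmb_laurentHom, hahnEmb_scalarHom,
      hahnEmb_eps, mul_assoc, div_mul_cancel₀ _ hq0, HahnSeries.C_apply,
      HahnSeries.single_mul_single, zero_add, mul_one]
  have key2 := congrArg HahnSeries.orderTop key
  rw [HahnSeries.orderTop_mul, HahnSeries.orderTop_mul, orderTop_hahnHom_one_add hp,
    orderTop_hahnHom_one_add hq, add_zero, add_zero] at key2
  rw [key2]
  exact HahnSeries.orderTop_single_le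

theorem zero_le_orderTop_of_mem_valRing {x : K} (h : x ∈ valRing Γ R F K) :
    0 ≤ (hahnEmb (Γ := Γ) R K x).orderTop := by
  rcases h with rfl | ⟨r, g, hg, h⟩
  · simp
  · exact le_trans (by exact_mod_cast hg) (le_orderTop_of_hasNormalForm h)

theorem zero_lt_orderTop_of_mem_valIdeal {x : K} (h : x ∈ valIdeal Γ R F K) :
    0 < (hahnEmb (Γ := Γ) R K x).orderTop := by
  rcases h with rfl | ⟨r, g, hg, h⟩
  · simp
  · exact lt_of_lt_of_le (by exact_mod_cast hg) (le_orderTop_of_hasNormalForm h)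

theorem laurentHom_injective : Function.Injective (laurentHom (Γ := Γ) R F K) := by
  intro p q h
  refine hahnHom_injective (complexHom R F).injective ?_
  rw [← hahnEmb_laurentHom R F K, h, hahnEmb_laurentHom]

/-- Every element of `𝒪` has a constant term. -/
theorem exists_sub_scalarHom_mem_valIdeal {x : K} (h : x ∈ valRing Γ R F K) :
    ∃ r : F, x - scalarHom Γ R F K r ∈ valIdeal Γ R F K := by
  rcases h with rfl | ⟨r, g, hg, h⟩
  · exact ⟨0, by simp [valIdeal]⟩
  rcases hg.lt_or_eq with hg | rfl
  · exact ⟨0, by rw [map_zero, sub_zero]; exact Or.inr ⟨r, g, hg, h⟩⟩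
  refine ⟨r, ?_⟩
  obtain ⟨p, q, hp, hq, rfl⟩ := h
  have hq0 : laurentHom R F K (1 + q) ≠ 0 := by
    rw [map_ne_zero_iff _ laurentHom_injective]
    intro h
    have := orderTop_hahnHom_one_add (R := R) hq
    rw [h, map_zero, HahnSeries.orderTop_zero] at this
    exact WithTop.top_ne_coe this
  have heps : eps R K (0 : Γ) = 1 := by
    rw [eps, ← AddMonoidAlgebra.one_def, map_one]
  -- At `g = 0` the constant term is `r`: the remainder is `r (p - q) / (1 + q)`.
  have key : scalarHom Γ R F K r * eps R K (0 : Γ) *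
      (laurentHom R F K (1 + p) / laurentHom R F K (1 + q)) - scalarHom Γ R F K r =
      scalarHom Γ R F K r * (laurentHom R F K (p - q) / laurentHom R F K (1 + q)) := by
    rw [heps, mul_one]
    field_simp
    rw [← map_sub, add_sub_add_left_eq_sub]
  rw [key]
  by_cases hpq : p - q = 0
  · left; rw [hpq]; simp
  right
  obtain ⟨g, s, t, hs, ht, hpq', hg⟩ := exists_lowest_term hpq
  have hg0 : 0 < g := by
    have := Finsupp.support_sub (f := p.coeff) (g := q.coeff) hg
    rcases Finset.mem_union.mp this with h | h
    · exact hp g h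
    · exact hq g h
  -- Dividing `p - q` by its lowest term `s ε^g` leaves `1 + s⁻¹ ε^{-g} t`, which brings the
  -- remainder to normal form.
  refine ⟨r * s, g, hg0, AddMonoidAlgebra.single (-g) s⁻¹ * t, q, ?_, hq, ?_⟩
  · intro h hh
    rw [Finsupp.mem_support_iff, AddMonoidAlgebra.coeff_single_mul_apply, neg_neg] at hh
    have := ht _ (Finsupp.mem_support_iff.mpr (right_ne_zero_of_mul hh))
    exact pos_of_lt_add_right this
  · have h1 : p - q = AddMonoidAlgebra.single g s * (1 + AddMonoidAlgebra.single (-g) s⁻¹ * t) := by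
      rw [hpq', mul_add, mul_one, ← mul_assoc, AddMonoidAlgebra.single_mul_single, add_neg_cancel,
        mul_inv_cancel₀ hs, ← AddMonoidAlgebra.one_def, one_mul]
    rw [h1, map_mul, laurentHom_single, map_mul]
    ring

theorem sub_constTerm_mem_valIdeal {x : K} (h : x ∈ valRing Γ R F K) :
    x - scalarHom Γ R F K (constTerm Γ R F x) ∈ valIdeal Γ R F K :=
  Classical.epsilon_spec (exists_sub_scalarHom_mem_valIdeal h)

/-- Whichever constant is chosen, it differs from `x` by an element of positive order, so it must be
the coefficient at `0`. Computations with `constTerm` thereby become computations with Hahn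
coefficients. -/
theorem complexHom_constTerm {x : K} (h : x ∈ valRing Γ R F K) :
    complexHom R F (constTerm Γ R F x) = (hahnEmb (Γ := Γ) R K x).coeff 0 := by
  have h1 := zero_lt_orderTop_of_mem_valIdeal (sub_constTerm_mem_valIdeal h)
  have h2 := HahnSeries.coeff_eq_zero_of_lt_orderTop (i := (0 : Γ)) h1
  rw [map_sub, hahnEmb_scalarHom, HahnSeries.coeff_sub, HahnSeries.C_apply,
    HahnSeries.coeff_single_same, sub_eq_zero] at h2
  exact h2.symm

/-- The constant term is multiplicative on Hahn series with non-negative support. -/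
theorem coeff_zero_mul {x y : HahnSeries Γ ℂ} (hx : 0 ≤ x.orderTop) (hy : 0 ≤ y.orderTop) :
    (x * y).coeff 0 = x.coeff 0 * y.coeff 0 := by
  -- Removing the constant term of `x` leaves positive order, and multiplying by `y` keeps it
  -- positive.
  have h1 : 0 < (x - HahnSeries.single 0 (x.coeff 0)).orderTop := by
    refine lt_of_le_of_ne ?_ (Ne.symm (HahnSeries.orderTop_ne_of_coeff_eq_zero (by simp)))
    exact le_trans (le_min hx HahnSeries.orderTop_single_le) HahnSeries.min_orderTop_le_orderTop_sub
  have h2 : 0 < ((x - HahnSeries.single 0 (x.coeff 0)) * y).orderTop := by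
    rw [HahnSeries.orderTop_mul]
    exact add_pos_of_pos_of_nonneg h1 hy
  have h3 := HahnSeries.coeff_eq_zero_of_lt_orderTop (i := (0 : Γ)) h2
  rw [sub_mul, HahnSeries.coeff_sub, HahnSeries.coeff_single_zero_mul, sub_eq_zero] at h3
  exact h3

theorem neg_mem_valRing {x : K} (h : x ∈ valRing Γ R F K) : -x ∈ valRing Γ R F K := by
  rcases h with rfl | ⟨r, g, hg, p, q, hp, hq, rfl⟩
  · left; simp
  · exact Or.inr ⟨-r, g, hg, p, q, hp, hq, by rw [map_neg, neg_mul, neg_mul]⟩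

theorem coeff_hahnEmb_of_hasLowestTerm {c : K} {g : Γ} {r : F} (h : HasLowestTerm R F c g r) :
    (hahnEmb R K c).coeff g = complexHom R F r ∧ ∀ k < g, (hahnEmb R K c).coeff k = 0 := by
  obtain ⟨-, q, hq, rfl⟩ := h
  have h1 : ∀ k ≤ g, q.coeff k = 0 := by
    intro k hk
    by_contra h
    exact absurd (hq k (Finsupp.mem_support_iff.mpr h)) (not_lt.mpr hk)
  simp only [map_add, map_mul, hahnEmb_scalarHom, hahnEmb_eps, hahnEmb_laurentHom,
    HahnSeries.C_apply, HahnSeries.single_mul_single, zero_add, mul_one, HahnSeries.coeff_add,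
    coeff_hahnHom]
  refine ⟨by simp [h1 g le_rfl], fun k hk => ?_⟩
  rw [h1 k hk.le, HahnSeries.coeff_single_of_ne hk.ne]
  simp

/-- `aInv` and `fInv` are chosen independently; uniqueness makes them belong to the same lowest
term. -/
theorem hasLowestTerm_unique {c : K} {g g' : Γ} {r r' : F} (h : HasLowestTerm R F c g r)
    (h' : HasLowestTerm R F c g' r') : g = g' ∧ r = r' := by
  have h1 := coeff_hahnEmb_of_hasLowestTerm h
  have h2 := coeff_hahnEmb_of_hasLowestTerm h'
  have hr : complexHom R F r ≠ 0 := (map_ne_zero _).mpr h.1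
  have hr' : complexHom R F r' ≠ 0 := (map_ne_zero _).mpr h'.1
  obtain rfl : g = g' := by
    rcases lt_trichotomy g g' with hlt | heq | hlt
    · exact absurd (h1.1.symm.trans (h2.2 g hlt)) hr
    · exact heq
    · exact absurd (h2.1.symm.trans (h1.2 g' hlt)) hr'
  exact ⟨rfl, (complexHom R F).injective (h1.1.symm.trans h2.1)⟩

end HahnEmbedding

/-! ### Complex conjugation on Hahn series and sums of `x * star x` -/

section EvenOrder

variable {Γ : Type*} [AddCommGroup Γ] [LinearOrder Γ] [IsOrderedAddMonoid Γ]

/-- Coefficientwise complex conjugation of Hahn series. -/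
noncomputable instance : StarRing (HahnSeries Γ ℂ) where
  star x := x.map (starRingEnd ℂ)
  star_involutive x := by ext; simp
  star_mul x y := by
    change HahnSeries.map _ _ = HahnSeries.map _ _ * HahnSeries.map _ _
    rw [mul_comm x y]
    exact HahnSeries.map_mul ((starRingEnd ℂ : ℂ →+* ℂ) : ℂ →ₙ+* ℂ)
  star_add x y := by ext; simp

theorem coeff_star (x : HahnSeries Γ ℂ) (g : Γ) :
    (star x).coeff g = starRingEnd ℂ (x.coeff g) := rfl

theorem orderTop_star (x : HahnSeries Γ ℂ) : (star x).orderTop = x.orderTop := by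
  refine le_antisymm ?_ ?_ <;>
  · rw [HahnSeries.le_orderTop_iff_forall]
    intro j hj
    have := HahnSeries.coeff_eq_zero_of_lt_orderTop hj
    simpa [coeff_star] using this

theorem star_single (g : Γ) (r : ℂ) :
    star (HahnSeries.single g r) = HahnSeries.single g (starRingEnd ℂ r) := by
  ext h
  rw [coeff_star]
  by_cases hg : h = g
  · subst hg; simp
  · simp [HahnSeries.coeff_single_of_ne hg]

/-- A non-trivial sum of elements `x * star x` has an order divisible by two. -/
theorem exists_orderTop_sum_mul_star {ι : Type*} [Fintype ι] (x : ι → HahnSeries Γ ℂ)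
    (hx : ∃ i, x i ≠ 0) : ∃ a : Γ, (∑ i, x i * star (x i)).orderTop = ((a + a : Γ) : WithTop Γ) := by
  classical
  obtain ⟨i₀, hi₀⟩ := hx
  -- Let `a` be the least order among the `x i`. The coefficient of the sum at `a + a` is `∑ |(x
  -- i)_a|²`, which is positive, and everything below vanishes.
  obtain ⟨m, -, hm⟩ := Finset.exists_min_image Finset.univ (fun i => (x i).orderTop)
    ⟨i₀, Finset.mem_univ _⟩
  have hm0 : x m ≠ 0 := by
    rw [← HahnSeries.orderTop_lt_top]
    exact lt_of_le_of_lt (hm i₀ (Finset.mem_univ _)) (HahnSeries.orderTop_lt_top.mpr hi₀)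
  obtain ⟨a, ha⟩ := WithTop.ne_top_iff_exists.mp (HahnSeries.orderTop_ne_top.mpr hm0)
  have hnn : ∀ z : HahnSeries Γ ℂ, (a : WithTop Γ) ≤ z.orderTop →
      0 ≤ (HahnSeries.single (-a) (1 : ℂ) * z).orderTop := by
    intro z hz
    rw [HahnSeries.orderTop_mul, HahnSeries.orderTop_single one_ne_zero]
    refine le_trans (le_of_eq ?_) (add_le_add_right hz _)
    rw [← WithTop.coe_add, neg_add_cancel, WithTop.coe_zero]
  have hle : ∀ i, (a : WithTop Γ) ≤ (x i).orderTop := fun i => by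
    rw [ha]; exact hm i (Finset.mem_univ _)
  have hshift : HahnSeries.single (-a + -a) (1 : ℂ) * ∑ i, x i * star (x i) =
      ∑ i, (HahnSeries.single (-a) (1 : ℂ) * x i) * (HahnSeries.single (-a) (1 : ℂ) * star (x i)) := by
    rw [Finset.mul_sum]
    refine Finset.sum_congr rfl fun i _ => ?_
    rw [mul_mul_mul_comm, HahnSeries.single_mul_single, one_mul]
  have hcoeff0 : (HahnSeries.single (-a + -a) (1 : ℂ) * ∑ i, x i * star (x i)).coeff 0 =
      ((∑ i, Complex.normSq ((x i).coeff a) : ℝ) : ℂ) := by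
    rw [hshift, HahnSeries.coeff_sum, Complex.ofReal_sum]
    refine Finset.sum_congr rfl fun i _ => ?_
    rw [coeff_zero_mul (hnn _ (hle i)) (hnn _ (by rw [orderTop_star]; exact hle i)),
      HahnSeries.coeff_single_mul, HahnSeries.coeff_single_mul, coeff_star]
    simp [Complex.mul_conj]
  have hpos : 0 < ∑ i, Complex.normSq ((x i).coeff a) := by
    refine Finset.sum_pos' (fun i _ => Complex.normSq_nonneg _) ⟨m, Finset.mem_univ _, ?_⟩
    exact Complex.normSq_pos.mpr (HahnSeries.coeff_orderTop_ne ha.symm)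
  have hcoeff : (HahnSeries.single (-a + -a) (1 : ℂ) * ∑ i, x i * star (x i)).coeff 0 ≠ 0 := by
    rw [hcoeff0]
    exact_mod_cast hpos.ne'
  have horder : (HahnSeries.single (-a + -a) (1 : ℂ) * ∑ i, x i * star (x i)).orderTop = 0 := by
    refine le_antisymm (HahnSeries.orderTop_le_of_coeff_ne_zero hcoeff) ?_
    rw [HahnSeries.le_orderTop_iff_forall, hshift]
    intro j hj
    rw [HahnSeries.coeff_sum]
    refine Finset.sum_eq_zero fun i _ => HahnSeries.coeff_eq_zero_of_lt_orderTop ?_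
    refine lt_of_lt_of_le hj ?_
    rw [HahnSeries.orderTop_mul]
    exact add_nonneg (hnn _ (hle i)) (hnn _ (by rw [orderTop_star]; exact hle i))
  refine ⟨a, ?_⟩
  rw [HahnSeries.orderTop_mul, HahnSeries.orderTop_single one_ne_zero] at horder
  have hne : (∑ i, x i * star (x i)).orderTop ≠ ⊤ := by
    intro h
    rw [h] at horder
    exact WithTop.top_ne_coe horder
  obtain ⟨b, hb⟩ := WithTop.ne_top_iff_exists.mp hne
  rw [← hb] at horder ⊢
  have h1 : -a + -a + b = 0 := by exact_mod_cast horder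
  congr 1
  rw [← neg_add] at h1
  exact (neg_add_eq_zero.mp h1).symm

end EvenOrder

/-! ### The invariant Hermitian form and the parity of the order of Schur elements -/

section Unitarity

open HeckeAlgebra Matrix

section InvariantForm

variable {B W : Type*} [Fintype W] {𝕃 : Type*} [Field 𝕃] [StarRing 𝕃] {d : ℕ} (N : W → Matrix (Fin d) (Fin d) 𝕃)

/-- The Hermitian matrix that defines an invariant form. -/
def invariantForm : Matrix (Fin d) (Fin d) 𝕃 := ∑ w : W, (N w)ᴴ * N w

theorem conjTranspose_invariantForm : (invariantForm N)ᴴ = invariantForm N := by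
  simp [invariantForm, Matrix.conjTranspose_sum, Matrix.conjTranspose_mul]

theorem invariantForm_apply_self (b : Fin d) :
    invariantForm N b b = ∑ p : W × Fin d, N p.1 p.2 b * star (N p.1 p.2 b) := by
  simp only [invariantForm, Matrix.sum_apply, Matrix.mul_apply, Matrix.conjTranspose_apply,
    Fintype.sum_prod_type, mul_comm]

variable [Group W] {M : CoxeterMatrix B} {cs : CoxeterSystem M W} {N}

/-- The generator `T_s` is self-adjoint for the form: the terms with `ws` match after `w ↦ ws`, and
the parameter terms agree because `ξ` is fixed by `star`. -/
theorem invariantForm_mul_simple {ξ : W → 𝕃} (hξ : ∀ w, star (ξ w) = ξ w) {i : B}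
    (hN : ∀ w a b, (N w * N (cs.simple i)) a b = N (w * cs.simple i) a b + ξ w * N w a b) :
    invariantForm N * N (cs.simple i) = (N (cs.simple i))ᴴ * invariantForm N := by
  have hN' : ∀ w, N w * N (cs.simple i) = N (w * cs.simple i) + ξ w • N w := fun w => by
    ext a b; exact hN w a b
  rw [invariantForm, Matrix.sum_mul, Matrix.mul_sum]
  simp only [Matrix.mul_assoc, hN']
  simp only [← Matrix.mul_assoc, ← Matrix.conjTranspose_mul, hN']
  simp only [Matrix.mul_add, Matrix.conjTranspose_add, Matrix.add_mul, Matrix.conjTranspose_smul,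
    Finset.sum_add_distrib, Matrix.mul_smul, Matrix.smul_mul, hξ]
  congr 1
  refine Fintype.sum_equiv (Equiv.mulRight (cs.simple i)) _ _ fun w => ?_
  simp [mul_assoc]

/-- The adjoint of `T_w` is `T_{w⁻¹}`, since a reduced word is reversed when adjoints of the
self-adjoint generators are taken. -/
theorem invariantForm_mul (h1 : N 1 = 1) {ξ : B → W → 𝕃} (hξ : ∀ i w, star (ξ i w) = ξ i w)
    (hN : ∀ i w a b, (N w * N (cs.simple i)) a b = N (w * cs.simple i) a b + ξ i w * N w a b)
    (hl : ∀ i w, cs.length w < cs.length (cs.simple i * w) →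
      N (cs.simple i * w) = N (cs.simple i) * N w)
    (hr : ∀ i w, cs.length w < cs.length (w * cs.simple i) →
      N (w * cs.simple i) = N w * N (cs.simple i)) (w : W) :
    invariantForm N * N w = (N w⁻¹)ᴴ * invariantForm N := by
  induction w using simple_mul_induction cs with
  | one => simp [h1]
  | simple_mul i w hw ih =>
    have h : cs.length w⁻¹ < cs.length (w⁻¹ * cs.simple i) := by
      rw [cs.length_inv, ← cs.length_inv (w⁻¹ * cs.simple i)]
      simpa using hw
    rw [hl i w hw, ← Matrix.mul_assoc, invariantForm_mul_simple (hξ i) (hN i), Matrix.mul_assoc,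
      ih, ← Matrix.mul_assoc, ← Matrix.conjTranspose_mul, ← hr i _ h, _root_.mul_inv_rev, cs.inv_simple]

/-- Adjointness turns the conjugate of `(B N_w)_{bb}` into `(B N_{w⁻¹})_{bb}`, after which the Schur
relation evaluates the sum. The left side has the shape `∑ z z̄`, while `c` enters the right side
linearly; this exposes the parity of its order. -/
theorem sum_invariantForm_mul_star
    (hB : ∀ w, invariantForm N * N w = (N w⁻¹)ᴴ * invariantForm N) {c : 𝕃} {b : Fin d}
    (hschur : ∀ i k, ∑ w : W, N w i b * N w⁻¹ k b = if i = b ∧ b = k then c else 0) :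
    ∑ w, (invariantForm N * N w) b b * star ((invariantForm N * N w) b b) =
      invariantForm N b b * invariantForm N b b * c := by
  have hstar : ∀ w, star ((invariantForm N * N w) b b) = (invariantForm N * N w⁻¹) b b := by
    intro w
    rw [← Matrix.conjTranspose_apply, Matrix.conjTranspose_mul, conjTranspose_invariantForm,
      hB, inv_inv]
  simp only [hstar]
  simp only [Matrix.mul_apply, Finset.sum_mul_sum]
  rw [Finset.sum_comm.trans (Finset.sum_congr rfl fun i _ => Finset.sum_comm)]
  have : ∀ i k : Fin d, ∑ w : W, invariantForm N b i * N w i b * (invariantForm N b k * N w⁻¹ k b) =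
      invariantForm N b i * invariantForm N b k * if i = b ∧ b = k then c else 0 := by
    intro i k
    rw [← hschur, Finset.mul_sum]
    exact Finset.sum_congr rfl fun w _ => by ring
  simp only [this]
  rw [Finset.sum_eq_single b, Finset.sum_eq_single b]
  · simp
  · intro k _ hk
    simp [hk.symm]
  · simp
  · intro i _ hi
    simp [hi]
  · simp

end InvariantForm

variable {B W : Type*} [Group W] {M : CoxeterMatrix B} {cs : CoxeterSystem M W}
  {Γ : Type*} [AddCommGroup Γ] [LinearOrder Γ] [IsOrderedAddMonoid Γ] {L : WeightFunction cs Γ}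
  {R : Subring ℂ} {K : Type*} [Field K] [Algebra (AddMonoidAlgebra R Γ) K]
  [IsFractionRing (AddMonoidAlgebra R Γ) K] {d : ℕ} (ρ : MatrixRep L R K d)

theorem star_hahnHom_heckeParam (i : B) :
    star (hahnHom R.subtype (heckeParam L R i)) = hahnHom R.subtype (heckeParam L R i) := by
  rw [heckeParam, map_sub, hahnHom_single, hahnHom_single, star_sub, star_single, star_single]
  simp

/-- The matrix `ρ(T_w)` over the field of Hahn series. -/
noncomputable def hahnRepT (w : W) : Matrix (Fin d) (Fin d) (HahnSeries Γ ℂ) :=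
  (repT ρ w).map (hahnEmb R K)

theorem hahnRepT_mul (v w : W) :
    hahnRepT ρ v * hahnRepT ρ w = (repT ρ v * repT ρ w).map (hahnEmb (Γ := Γ) R K) :=
  (Matrix.map_mul ..).symm

open Classical in
theorem hahnRepT_mul_simple (w : W) (i : B) (a b : Fin d) :
    (hahnRepT ρ w * hahnRepT ρ (cs.simple i)) a b = hahnRepT ρ (w * cs.simple i) a b +
      (if cs.length w < cs.length (w * cs.simple i) then 0
        else hahnHom R.subtype (heckeParam L R i)) * hahnRepT ρ w a b := by
  have h := congrArg (repH ρ) (T_mul_T_simple L R w i)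
  rw [map_mul, map_add, map_smul, repH_T, repH_T, repH_T] at h
  rw [hahnRepT_mul, h, Matrix.map_apply, Matrix.add_apply, Matrix.smul_apply, map_add,
    Algebra.smul_def, map_mul, hahnEmb_algebraMap, apply_ite (hahnHom R.subtype), map_zero]
  rfl

theorem hahnRepT_mul_simple_of_lt (i : B) (w : W)
    (h : cs.length w < cs.length (w * cs.simple i)) :
    hahnRepT ρ (w * cs.simple i) = hahnRepT ρ w * hahnRepT ρ (cs.simple i) := by
  ext1 a b
  rw [hahnRepT_mul_simple, if_pos h, zero_mul, add_zero]

theorem hahnRepT_simple_mul_of_lt (i : B) (w : W)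
    (h : cs.length w < cs.length (cs.simple i * w)) :
    hahnRepT ρ (cs.simple i * w) = hahnRepT ρ (cs.simple i) * hahnRepT ρ w := by
  rw [hahnRepT_mul, ← repH_T ρ w, ← repH_T, ← map_mul, T_simple_mul_T_of_lt L R h]
  rfl

theorem hahnRepT_one : hahnRepT ρ (1 : W) = 1 := by
  rw [hahnRepT, repT_one, Matrix.map_one _ (map_zero _) (map_one _)]

variable [Fintype W]

variable {ρ} in
/-- An element satisfying the Schur relations has an order divisible by two. -/
theorem exists_orderTop_eq_add_self {c : K} (hc : c ≠ 0) (b : Fin d)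
    (hschur : ∀ i j k n : Fin d, ∑ w : W, repT ρ w i j * repT ρ w⁻¹ k n =
      if i = n ∧ j = k then c else 0) :
    ∃ a : Γ, (hahnEmb (Γ := Γ) R K c).orderTop = ((a + a : Γ) : WithTop Γ) := by
  classical
  have hc' : hahnEmb (Γ := Γ) R K c ≠ 0 := (map_ne_zero _).mpr hc
  have hschur' : ∀ i k : Fin d, ∑ w : W, hahnRepT ρ w i b * hahnRepT ρ w⁻¹ k b =
      if i = b ∧ b = k then hahnEmb R K c else 0 := by
    intro i k
    have := congrArg (hahnEmb (Γ := Γ) R K) (hschur i b k b)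
    simp only [map_sum, map_mul] at this
    rw [apply_ite (hahnEmb (Γ := Γ) R K), map_zero] at this
    exact this
  have key := sum_invariantForm_mul_star
    (invariantForm_mul (N := hahnRepT ρ) (hahnRepT_one ρ)
      (fun i w => by
        rw [apply_ite star, star_zero, star_hahnHom_heckeParam])
      (fun i w => hahnRepT_mul_simple ρ w i)
      (hahnRepT_simple_mul_of_lt ρ) (hahnRepT_mul_simple_of_lt ρ)) hschur'
  -- The diagonal entry is itself a sum of terms `z z̄`, non-trivial because of the term of `w = 1`.
  obtain ⟨β, hβ⟩ : ∃ β : Γ, (invariantForm (hahnRepT ρ) b b).orderTop =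
      ((β + β : Γ) : WithTop Γ) := by
    rw [invariantForm_apply_self]
    exact exists_orderTop_sum_mul_star _ ⟨(1, b), by rw [hahnRepT_one]; simp⟩
  have hB0 : invariantForm (hahnRepT ρ) b b ≠ 0 := by
    intro h
    rw [h, HahnSeries.orderTop_zero] at hβ
    exact WithTop.top_ne_coe hβ
  obtain ⟨a, ha⟩ := exists_orderTop_sum_mul_star
    (fun w => (invariantForm (hahnRepT ρ) * hahnRepT ρ w) b b) (by
      by_contra! h
      simp only [h, zero_mul, Finset.sum_const_zero] at key
      exact mul_ne_zero (mul_ne_zero hB0 hB0) hc' key.symm)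
  rw [key, HahnSeries.orderTop_mul, HahnSeries.orderTop_mul, hβ] at ha
  obtain ⟨g, hg⟩ := WithTop.ne_top_iff_exists.mp (HahnSeries.orderTop_ne_top.mpr hc')
  rw [← hg] at ha ⊢
  have h1 : β + β + (β + β) + g = a + a := by exact_mod_cast ha
  -- If `g` is the order of `c`, then `4β + g = 2a`.
  refine ⟨a - (β + β), ?_⟩
  congr 1
  rw [eq_sub_of_add_eq' h1]
  abel

end Unitarity

/-! ### From orthogonality of leading coefficients to the algebra structure -/

section JTildeAlgebra

open Matrix

variable {B W : Type*} [Group W] [Fintype W] {M : CoxeterMatrix B} {cs : CoxeterSystem M W}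
  {Γ : Type*} [AddCommGroup Γ] [LinearOrder Γ] [IsOrderedAddMonoid Γ]
  {L : WeightFunction cs Γ} {R : Type*} [CommRing R] [IsDomain R]
  {F : Type*} [Field F] [Algebra R F] [IsFractionRing R F]
  {K : Type*} [Field K] [Algebra (AddMonoidAlgebra R Γ) K]
  [IsFractionRing (AddMonoidAlgebra R Γ) K]
  {Λ : Type*} {d : Λ → ℕ} (ρ : ∀ l, MatrixRep L R K (d l))

variable (F) in
/-- The matrix of leading coefficients at `w`. -/
noncomputable def leadMatrix (l : Λ) (w : W) : Matrix (Fin (d l)) (Fin (d l)) F :=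
  Matrix.of (leadCoeff F (ρ l) w)

variable (F) in
/-- The linear map from `J̃` to a product of matrix algebras with `t_w ↦ (c_{w,λ})_λ`. -/
noncomputable def jRep : (W →₀ F) →ₗ[F] ∀ l, Matrix (Fin (d l)) (Fin (d l)) F :=
  Finsupp.linearCombination F fun w l => leadMatrix F ρ l w

theorem jRep_single (w : W) (l : Λ) : jRep F ρ (Finsupp.single w 1) l = leadMatrix F ρ l w := by
  simp [jRep]

variable [Fintype Λ]

variable (F) in
/-- The orthogonality relations for the leading matrix coefficients. -/
structure LeadOrthogonality : Prop where
  fInv_ne_zero : ∀ l, fInv F (ρ l) ≠ 0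
  sum_of_ne : ∀ l m, l ≠ m → ∀ i j k n,
    ∑ w : W, leadCoeff F (ρ l) w i j * leadCoeff F (ρ m) w⁻¹ k n = 0
  sum_self : ∀ l i j k n, ∑ w : W, leadCoeff F (ρ l) w i j * leadCoeff F (ρ l) w⁻¹ k n =
    if i = n ∧ j = k then fInv F (ρ l) else 0

variable {ρ}

/-- The orthogonality relations reconstruct a family of matrices from its traces against the
matrices of leading coefficients. -/
theorem sum_trace_smul_leadMatrix (h : LeadOrthogonality F ρ)
    (X : ∀ l, Matrix (Fin (d l)) (Fin (d l)) F) (m : Λ) :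
    ∑ z : W, (∑ l, (fInv F (ρ l))⁻¹ * (X l * leadMatrix F ρ l z⁻¹).trace) • leadMatrix F ρ m z =
      X m := by
  classical
  ext a b
  simp only [Matrix.sum_apply, Matrix.smul_apply, smul_eq_mul, Finset.sum_mul]
  rw [Finset.sum_comm]
  have hl : ∀ l, ∑ z : W, (fInv F (ρ l))⁻¹ * (X l * leadMatrix F ρ l z⁻¹).trace *
      leadMatrix F ρ m z a b = (fInv F (ρ l))⁻¹ * ∑ i, ∑ k, X l i k *
        ∑ z : W, leadCoeff F (ρ m) z a b * leadCoeff F (ρ l) z⁻¹ k i := by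
    intro l
    simp only [Matrix.trace, Matrix.diag_apply, Matrix.mul_apply, Finset.mul_sum, Finset.sum_mul]
    rw [Finset.sum_comm.trans (Finset.sum_congr rfl fun i _ => Finset.sum_comm)]
    refine Finset.sum_congr rfl fun i _ => Finset.sum_congr rfl fun k _ =>
      Finset.sum_congr rfl fun z _ => ?_
    simp only [leadMatrix, Matrix.of_apply]
    ring
  simp only [hl]
  -- Orthogonality leaves only `l = m` and the indices `(i, k) = (a, b)`, where `f_m` cancels its
  -- inverse.
  rw [Finset.sum_eq_single m]
  · simp only [h.sum_self]
    rw [Finset.sum_eq_single a, Finset.sum_eq_single b]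
    · simp only [and_self, if_true]
      field_simp [h.fInv_ne_zero m]
    · intro k _ hk
      simp [hk.symm]
    · simp
    · intro i _ hi
      simp [hi.symm]
    · simp
  · intro l _ hlm
    simp [h.sum_of_ne m l hlm.symm]
  · simp

/-- Written as traces, the structure constants are the coefficients that `sum_trace_smul_leadMatrix`
attaches to a product of two leading matrices. -/
theorem gammaTilde_eq (x y z : W) : gammaTilde F ρ x y z =
    ∑ l, (fInv F (ρ l))⁻¹ *
      ((leadMatrix F ρ l x * leadMatrix F ρ l y) * leadMatrix F ρ l z).trace := by
  rw [gammaTilde]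
  refine Finset.sum_congr rfl fun l _ => ?_
  simp only [Matrix.trace, Matrix.diag_apply, Matrix.mul_apply, Finset.mul_sum, Finset.sum_mul,
    leadMatrix, Matrix.of_apply]
  refine Finset.sum_congr rfl fun i _ => ?_
  rw [Finset.sum_comm]
  exact Finset.sum_congr rfl fun k _ => Finset.sum_congr rfl fun j _ => by ring

theorem nTilde_eq (w : W) : nTilde F ρ w =
    ∑ l, (fInv F (ρ l))⁻¹ * (1 * leadMatrix F ρ l w⁻¹).trace := by
  rw [nTilde]
  refine Finset.sum_congr rfl fun l _ => ?_
  simp only [Matrix.one_mul, Matrix.trace, Matrix.diag_apply, Finset.mul_sum, leadMatrix,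
    Matrix.of_apply]

theorem jMul_single (x y : W) : jMul F ρ (Finsupp.single x 1) (Finsupp.single y 1) =
    ∑ z : W, gammaTilde F ρ x y z⁻¹ • Finsupp.single z 1 := by
  have h : ∀ w : W, (Finsupp.single w 1 : W →₀ F) = Finsupp.basisSingleOne w := fun w => by simp
  rw [jMul, h x, Module.Basis.constr_basis, h y, Module.Basis.constr_basis]

theorem jRep_jMul (horth : LeadOrthogonality F ρ) (x y : W →₀ F) :
    jRep F ρ (jMul F ρ x y) = jRep F ρ x * jRep F ρ y := by
  have h : (jMul F ρ).compr₂ (jRep F ρ) =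
      (LinearMap.mul F (∀ l, Matrix (Fin (d l)) (Fin (d l)) F)).compl₁₂ (jRep F ρ) (jRep F ρ) := by
    refine Finsupp.basisSingleOne.ext fun x => Finsupp.basisSingleOne.ext fun y => ?_
    funext m
    simp only [Finsupp.coe_basisSingleOne, LinearMap.compr₂_apply, LinearMap.compl₁₂_apply,
      LinearMap.mul_apply', jMul_single, map_sum, map_smul, Finset.sum_apply, Pi.smul_apply,
      Pi.mul_apply, jRep_single, gammaTilde_eq]
    exact sum_trace_smul_leadMatrix horth
      (fun l => leadMatrix F ρ l x * leadMatrix F ρ l y) m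
  exact LinearMap.congr_fun₂ h x y

theorem jRep_jOne (horth : LeadOrthogonality F ρ) : jRep F ρ (jOne F ρ) = 1 := by
  classical
  have h : jOne F ρ = ∑ w : W, nTilde F ρ w • Finsupp.single w 1 := by
    rw [jOne, Finset.sum_filter]
    refine Finset.sum_congr rfl fun w _ => ?_
    split_ifs with hw
    · rfl
    · rw [not_not.mp hw, zero_smul]
  funext m
  simp only [h, map_sum, map_smul, Finset.sum_apply, Pi.smul_apply, jRep_single, nTilde_eq]
  exact sum_trace_smul_leadMatrix horth (fun l => 1) m

/-- Surjectivity is immediate from the reconstruction formula, and the dimensions agree. -/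
theorem jRep_injective (horth : LeadOrthogonality F ρ) (hd : ∑ l, d l * d l = Fintype.card W) :
    Function.Injective (jRep F ρ) := by
  have hfr : Module.finrank F (W →₀ F) =
      Module.finrank F (∀ l, Matrix (Fin (d l)) (Fin (d l)) F) := by
    rw [Module.finrank_finsupp_self, Module.finrank_pi_fintype, ← hd]
    simp [Module.finrank_matrix]
  rw [LinearMap.injective_iff_surjective_of_finrank_eq_finrank hfr]
  intro X
  refine ⟨∑ z : W, (∑ l, (fInv F (ρ l))⁻¹ * (X l * leadMatrix F ρ l z⁻¹).trace) •
    Finsupp.single z 1, ?_⟩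
  funext m
  simp only [map_sum, map_smul, Finset.sum_apply, Pi.smul_apply, jRep_single]
  exact sum_trace_smul_leadMatrix horth X m

/-- The orthogonality relations for leading coefficients imply that `J̃` is an associative algebra
with identity element. -/
theorem jMul_assoc_and_one (horth : LeadOrthogonality F ρ)
    (hd : ∑ l, d l * d l = Fintype.card W) :
    (∀ x y z : W →₀ F, jMul F ρ (jMul F ρ x y) z = jMul F ρ x (jMul F ρ y z)) ∧
      ∀ x : W →₀ F, jMul F ρ (jOne F ρ) x = x ∧ jMul F ρ x (jOne F ρ) = x := by
  have hinj := jRep_injective horth hd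
  have hmul := jRep_jMul horth
  have hone := jRep_jOne horth
  refine ⟨fun x y z => hinj ?_, fun x => ⟨hinj ?_, hinj ?_⟩⟩
  · simp only [hmul, mul_assoc]
  · rw [hmul, hone, one_mul]
  · rw [hmul, hone, mul_one]

end JTildeAlgebra

/-! ### The specialisation `ε^g ↦ 1` -/

section Specialization

variable {B W : Type*} [Group W] {M : CoxeterMatrix B} {cs : CoxeterSystem M W}
  {Γ : Type*} [AddCommGroup Γ] {L : WeightFunction cs Γ} {R : Subring ℂ}

/-- The homomorphism `R[Γ] → ℂ` with `ε^g ↦ 1`. -/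
noncomputable def thetaComplex : AddMonoidAlgebra R Γ →+* ℂ :=
  R.subtype.comp (theta R : AddMonoidAlgebra R Γ →ₐ[R] R).toRingHom

theorem thetaComplex_heckeParam (i : B) : thetaComplex (heckeParam L R i) = 0 := by
  simp [thetaComplex, heckeParam, theta]

end Specialization

/-! ### Lowest terms of Schur elements and orthogonality of leading coefficients -/

section LeadingCoefficients

variable {B W : Type*} [Group W] [Fintype W] {M : CoxeterMatrix B} {cs : CoxeterSystem M W}
  {Γ : Type*} [AddCommGroup Γ] [LinearOrder Γ] [IsOrderedAddMonoid Γ] {L : WeightFunction cs Γ}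
  {R : Subring ℂ} {F : Type*} [Field F] [Algebra R F] [IsFractionRing R F]
  {K : Type*} [Field K] [Algebra (AddMonoidAlgebra R Γ) K]
  [IsFractionRing (AddMonoidAlgebra R Γ) K]

theorem charZero_of_isFractionRing (Γ : Type*) [AddCommGroup Γ] [LinearOrder Γ]
    [IsOrderedAddMonoid Γ] (R : Subring ℂ) (K : Type*) [Field K] [Algebra (AddMonoidAlgebra R Γ) K]
    [IsFractionRing (AddMonoidAlgebra R Γ) K] : CharZero K := by
  have : CharZero (HahnSeries Γ ℂ) :=
    charZero_of_injective_ringHom (HahnSeries.C_injective (Γ := Γ) (R := ℂ))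
  exact ((hahnEmb (Γ := Γ) R K).charZero_iff (hahnEmb (Γ := Γ) R K).injective).mpr this

variable (F) in
theorem laurentHom_mapRingHom (p : AddMonoidAlgebra R Γ) :
    laurentHom R F K (AddMonoidAlgebra.mapRingHom Γ (algebraMap R F) p) =
      algebraMap (AddMonoidAlgebra R Γ) K p := by
  refine (hahnEmb (Γ := Γ) R K).injective ?_
  rw [hahnEmb_laurentHom, hahnEmb_algebraMap]
  ext g
  rw [coeff_hahnHom, coeff_hahnHom]
  simp [complexHom_algebraMap]

variable {d : ℕ} {ρ : MatrixRep L R K d}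

variable (F) in
-- The traces lie in `R[Γ]`, and division by `d` requires only coefficients in `F`. A Schur element
-- is thus a Laurent polynomial and, if non-zero, has a lowest term.
theorem exists_laurentHom_eq_schurElement {a : W → AddMonoidAlgebra R Γ}
    (ha : ∀ w, algebraMap _ K (a w) = (repT ρ w).trace) :
    ∃ p : AddMonoidAlgebra F Γ, laurentHom R F K p = schurElement ρ := by
  refine ⟨AddMonoidAlgebra.single 0 (d : F)⁻¹ *
    AddMonoidAlgebra.mapRingHom Γ (algebraMap R F) (∑ w, a w * a w⁻¹), ?_⟩
  have heps : eps R K (0 : Γ) = 1 := by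
    rw [eps, ← AddMonoidAlgebra.one_def, map_one]
  rw [map_mul, laurentHom_mapRingHom, laurentHom_single, heps, mul_one, map_inv₀, map_natCast,
    schurElement]
  simp only [map_sum, map_mul, ha]

theorem schurElement_ne_zero {a : W → AddMonoidAlgebra R Γ}
    (ha : ∀ w, algebraMap _ K (a w) = (repT ρ w).trace) (hd : d ≠ 0)
    (hsum : ∑ w, thetaComplex (a w) * thetaComplex (a w⁻¹) ≠ 0) : schurElement ρ ≠ 0 := by
  have := charZero_of_isFractionRing Γ R K
  refine mul_ne_zero (inv_ne_zero (Nat.cast_ne_zero.mpr hd)) ?_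
  simp only [← ha, ← map_mul, ← map_sum]
  rw [map_ne_zero_iff _ (IsFractionRing.injective (AddMonoidAlgebra R Γ) K)]
  intro h
  apply hsum
  simp only [← map_mul, ← map_sum, h, map_zero]

variable (F) in
/-- The invariants `a_λ` and `f_λ` do describe the lowest term of the Schur element. -/
theorem hasLowestTerm_schurElement {a : W → AddMonoidAlgebra R Γ}
    (ha : ∀ w, algebraMap _ K (a w) = (repT ρ w).trace) (b : Fin d)
    (hsum : ∑ w, thetaComplex (a w) * thetaComplex (a w⁻¹) ≠ 0)
    (hschur : ∀ i j k n : Fin d, ∑ w : W, repT ρ w i j * repT ρ w⁻¹ k n =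
      if i = n ∧ j = k then schurElement ρ else 0) :
    HasLowestTerm R F (schurElement ρ) (-(2 • aInv F ρ)) (fInv F ρ) := by
  have hc := schurElement_ne_zero ha (Nat.ne_zero_of_lt b.pos) hsum
  obtain ⟨p, hp⟩ := exists_laurentHom_eq_schurElement F ha
  have hp0 : p ≠ 0 := by
    rintro rfl
    exact hc (by rw [← hp, map_zero])
  obtain ⟨g, r, q, hr, hq, hpq, -⟩ := exists_lowest_term hp0
  have hlow : HasLowestTerm R F (schurElement ρ) g r :=
    ⟨hr, q, hq, by rw [← hp, hpq, map_add, laurentHom_single]⟩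
  obtain ⟨α, hα⟩ := exists_orderTop_eq_add_self hc b hschur
  -- The order of the Schur element is `2α`, so `-α` can serve as `a_λ`.
  have hg : g = -(2 • (-α)) := by
    obtain ⟨h1, h2⟩ := coeff_hahnEmb_of_hasLowestTerm hlow
    have h3 : (hahnEmb (Γ := Γ) R K (schurElement ρ)).coeff g ≠ 0 := by
      rw [h1]; exact (map_ne_zero _).mpr hr
    have h4 := HahnSeries.orderTop_le_of_coeff_ne_zero h3
    rw [hα, WithTop.coe_le_coe] at h4
    rcases h4.lt_or_eq with h | h
    · exact absurd (h2 _ h) (HahnSeries.coeff_orderTop_ne hα)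
    · rw [← h, smul_neg, neg_neg, two_nsmul]
  rw [hg] at hlow
  have ha' : ∃ f : F, HasLowestTerm R F (schurElement ρ) (-(2 • aInv F ρ)) f :=
    Classical.epsilon_spec (p := fun a : Γ => ∃ f : F,
      HasLowestTerm R F (schurElement ρ) (-(2 • a)) f) ⟨_, _, hlow⟩
  have hf' : ∃ a : Γ, HasLowestTerm R F (schurElement ρ) (-(2 • a)) (fInv F ρ) :=
    Classical.epsilon_spec (p := fun f : F => ∃ a : Γ,
      HasLowestTerm R F (schurElement ρ) (-(2 • a)) f) ⟨_, _, hlow⟩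
  obtain ⟨f, hf⟩ := ha'
  obtain ⟨a', ha'⟩ := hf'
  rwa [← (hasLowestTerm_unique hf ha').2]

theorem mem_valRing_of_isBalanced (hbal : IsBalanced F ρ) (w : W) (i j : Fin d) :
    (-1) ^ cs.length w * eps R K (aInv F ρ) * repT ρ w i j ∈ valRing Γ R F K := by
  rcases neg_one_pow_eq_or K (cs.length w) with h | h
  · rw [h, one_mul]
    exact hbal w i j
  · rw [h, neg_one_mul, neg_mul]
    exact neg_mem_valRing (hbal w i j)

/-- Both factors have non-negative order, so the product of constant terms is the constant term of
the product. The signs cancel because `ℓ(w⁻¹) = ℓ(w)`, and the powers of `ε` leave the sum over `w`.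
-/
theorem complexHom_sum_leadCoeff_mul {e : ℕ} {σ : MatrixRep L R K e} (hρ : IsBalanced F ρ)
    (hσ : IsBalanced F σ) (i j : Fin d) (k n : Fin e) :
    complexHom R F (∑ w : W, leadCoeff F ρ w i j * leadCoeff F σ w⁻¹ k n) =
      (hahnEmb (Γ := Γ) R K (eps R K (aInv F ρ + aInv F σ) *
        ∑ w : W, repT ρ w i j * repT σ w⁻¹ k n)).coeff (0 : Γ) := by
  rw [Finset.mul_sum, map_sum, map_sum, HahnSeries.coeff_sum]
  refine Finset.sum_congr rfl fun w _ => ?_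
  have hρ' := mem_valRing_of_isBalanced hρ w i j
  have hσ' := mem_valRing_of_isBalanced hσ w⁻¹ k n
  rw [map_mul, leadCoeff, leadCoeff, complexHom_constTerm hρ', complexHom_constTerm hσ',
    ← coeff_zero_mul (zero_le_orderTop_of_mem_valRing hρ') (zero_le_orderTop_of_mem_valRing hσ'),
    ← map_mul, cs.length_inv]
  have hsign : ((-1 : K) ^ cs.length w) * (-1) ^ cs.length w = 1 := by
    rw [← mul_pow]; simp
  have heps : eps R K (aInv F ρ + aInv F σ) = eps R K (aInv F ρ) * eps R K (aInv F σ) := by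
    rw [eps, eps, eps, ← map_mul, AddMonoidAlgebra.single_mul_single, one_mul]
  congr 2
  rw [heps]
  linear_combination (eps R K (aInv F ρ) * repT ρ w i j * eps R K (aInv F σ) * repT σ w⁻¹ k n) *
    hsign

end LeadingCoefficients

end IwahoriHecke

/-! ### Assembling the theorem -/

theorem proposition3p3
    -- a finite Coxeter group `W`, an ordered abelian group `Γ`, a positive weight function `L`
    {B W : Type*} [Group W] [Fintype W] {M : CoxeterMatrix B} (cs : CoxeterSystem M W)
    {Γ : Type*} [AddCommGroup Γ] [LinearOrder Γ] [IsOrderedAddMonoid Γ]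
    (L : WeightFunction cs Γ) (hL : ∀ i : B, 0 < L.toFun (cs.simple i))
    -- a subring `R` of `ℂ` containing `2 cos (2π / m_st)`, with `F = Frac R` and `K = Frac R[Γ]`
    (R : Subring ℂ)
    (hR : ∀ i j : B,
      ((2 * Real.cos (2 * Real.pi / orderOf (cs.simple i * cs.simple j)) : ℝ) : ℂ) ∈ R)
    (F : Type*) [Field F] [Algebra R F] [IsFractionRing R F]
    (K : Type*) [Field K] [Algebra (AddMonoidAlgebra R Γ) K]
    [IsFractionRing (AddMonoidAlgebra R Γ) K]
    -- the irreducible representations of `W`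
    {Λ : Type*} [Fintype Λ] {d : Λ → ℕ}
    (E : ∀ l, Representation ℂ W (Fin (d l) → ℂ)) (hE : IsCompleteIrr E)
    -- for each of them, a balanced matrix representation of `H_K` that corresponds to it
    (ρ : ∀ l, MatrixRep L R K (d l)) (hρ : ∀ l, IsAffordedBy (ρ l) (E l))
    (hbal : ∀ l, IsBalanced F (ρ l)) :
    (∀ x y z : W →₀ F, jMul F ρ (jMul F ρ x y) z = jMul F ρ x (jMul F ρ y z)) ∧
      ∀ x : W →₀ F, jMul F ρ (jOne F ρ) x = x ∧ jMul F ρ x (jOne F ρ) = x := by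
  classical
  have := charZero_of_isFractionRing Γ R K
  have : FaithfulSMul (AddMonoidAlgebra R Γ) K :=
    (faithfulSMul_iff_algebraMap_injective _ _).mpr
      (IsFractionRing.injective (AddMonoidAlgebra R Γ) K)
  choose a ha haE using fun l => (hρ l).2
  have haE' : ∀ l w, thetaComplex (a l w) = (E l).character w := haE
  have hsurj := exists_sum_smul_repT_eq ρ thetaComplex_heckeParam hE ha haE'
  -- At `ε^g ↦ 1` the sum defining `d_l c_l` becomes `|W|`, so the Schur elements do not vanish.
  have hsum : ∀ l, ∑ w, thetaComplex (a l w) * thetaComplex (a l w⁻¹) ≠ 0 := by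
    intro l
    simp only [haE', sum_character_mul_character_inv hE, if_true]
    simp
  have hlow : ∀ l, HasLowestTerm R F (schurElement (ρ l)) (-(2 • aInv F (ρ l)))
      (fInv F (ρ l)) := fun l =>
    hasLowestTerm_schurElement F (ha l) ⟨0, Nat.pos_of_ne_zero (hρ l).1.1⟩ (hsum l)
      (schur_relation_self hsurj l)
  refine jMul_assoc_and_one ⟨fun l => (hlow l).1, ?_, ?_⟩ (sum_dim_sq hE)
  · intro l m hlm i j k n
    refine (complexHom R F).injective ?_
    rw [complexHom_sum_leadCoeff_mul (hbal l) (hbal m), schur_relation_of_ne hsurj hlm]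
    simp
  · intro l i j k n
    refine (complexHom R F).injective ?_
    rw [complexHom_sum_leadCoeff_mul (hbal l) (hbal l), schur_relation_self hsurj]
    split_ifs
    -- The constant term of `ε^{2 a_l} c_l` is the coefficient of `c_l` at `-2 a_l`, which is `f_l`.
    · rw [map_mul, hahnEmb_eps, HahnSeries.coeff_single_mul, one_mul, zero_sub, ← two_nsmul,
        (coeff_hahnEmb_of_hasLowestTerm (hlow l)).1]
    · simp
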